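/- Let $p(x)=\sum_{j=0}^n p_jT_j(x)$ be a polynomial of degree $n\ge 2$ with complex coefficients ($p_n\neq 0$) in the Chebyshev basis, and let $A=F+uv^*\in\mathbb C^{n\times n}$ be its colleague linearization: $F$ is the symmetric tridiagonal matrix with zero diagonal and off-diagonal entries $\tfrac12,\dots,\tfrac12,\tfrac{\sqrt2}{2}$, $u=e_1$, and $v^*=-\frac1{2p_n}\,[\,p_{n-1},\,p_{n-2},\dots,p_1,\,\sqrt2\,p_0\,]$. Structured QR iteration. A Hermitian-plus-rank-one matrix is stored through its lower triangular part (diagonal $d$, subdiagonal $\beta$, and the few entries, such as bulges, that temporarily appear below the subdiagonal) and the two vectors $u,v$; the entries above the diagonal are $A_{ij}=\overline{A_{ji}}-\overline{u_j}v_i+u_i\overline{v_j}$, $i<j$. The iteration starts from the entries of $A,u,v$, rounded when they are stored, and performs unitary similarities $A\mapsto G^*AG$, $u\mapsto G^*u$, $v\mapsto G^*v$ with Givens rotations $G$ (one rotation per step in the single-shift case, two in the double-shift case). After each of them only the lower triangular part of the updated matrix and the updated $u,v$ are kept. The rotations either start a bulge, for an arbitrary shift, or annihilate one (single shift) or two (double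 shift) stored entries of a column below the diagonal. A stored entry below the diagonal that is negligible, i.e. of modulus at most $2\epsilon_m$ times the spectral norm of the current matrix, may be replaced by $0$. Shifts and order of the steps are arbitrary, so that aggressive early deflation and the concurrent chasing of several bulges are included. When all the entries below the diagonal are zero, the upper triangular matrix $T$ determined by the final data is the computed Schur form. All operations are carried out in floating point arithmetic under the usual model: each real operation has relative error at most the unit roundoff $\epsilon_m>0$, complex arithmetic is done through real arithmetic, and there is no underflow or overflow. Theorem. Assume that the number of elementary steps (bulge starting or annihilation steps and deflations) performed until convergence is at most $q(n)$, where $q$ is a polynomial. Then there is a polynomial $P$ with nonnegative integer coefficients, depending only on $q$ and of degree at most $2\deg q+2$, such that for every $n\ge2$, every $p$ of degree $n$, every $\epsilon_m>0$ with $P(n)\,\epsilon_m\le 1$, and every $T$ computed by the structured QR iteration from $A$ in at most $q(n)$ elementary steps, $T$ is upper triangular and there are a unitary matrix $Q$ and a matrix $\delta A$ with $$T=Q^*(A+\delta A)Q,\qquad \|\delta A\|\le P(n)\,\|A\|\,\epsilon_m ,$$ where $\|\cdot\|$ is the spectral norm. (Here $q$ is taken with nonnegative integer coefficients.) -/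

import Mathlib

open scoped Matrix Matrix.Norms.L2Operator

noncomputable section

/-! ### The colleague matrix -/

/-- The `n × n` Hermitian matrix
`(1/2) * tridiag` with off-diagonal entries `1, …, 1, √2` (the `√2` couples the last two indices). -/
def colleagueF (n : ℕ) : Matrix (Fin n) (Fin n) ℂ := fun i j =>
  if (j : ℕ) = i + 1 ∨ (i : ℕ) = j + 1 then
    if (i : ℕ) + 1 = n ∨ (j : ℕ) + 1 = n then ((√2 / 2 : ℝ) : ℂ) else 1 / 2
  else 0

/-- The vector `e₁`. -/
def colleagueU (n : ℕ) : Fin n → ℂ := fun i => if (i : ℕ) = 0 then 1 else 0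

/-- The vector `v` with
`v* = -(1 / (2 pₙ)) * [pₙ₋₁, pₙ₋₂, …, p₁, √2 p₀]`. -/
def colleagueV (n : ℕ) (p : ℕ → ℂ) : Fin n → ℂ := fun j =>
  star (-(1 / (2 * p n)) *
    (if (j : ℕ) + 1 = n then ((√2 : ℝ) : ℂ) * p 0 else p (n - 1 - j)))

/-- The colleague linearization `A = F + u v*` of `∑_{j ≤ n} p j * T_j`. -/
def colleague (n : ℕ) (p : ℕ → ℂ) : Matrix (Fin n) (Fin n) ℂ :=
  colleagueF n + Matrix.vecMulVec (colleagueU n) (star (colleagueV n p))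

/-! ### Floating point arithmetic with unit roundoff `ε`

The usual model: every real operation returns the exact result up to a relative error of
size at most `ε` (no underflow or overflow); complex arithmetic is carried out through real
arithmetic. All notions are relations "`r` is a possible computed value". -/

/-- `r` is a possible rounding of the real number `x`. -/
def Fl (ε x r : ℝ) : Prop := |r - x| ≤ ε * |x|

/-- `r` is a possible rounding of the complex number `z` (real and imaginary part are rounded). -/
def FlC (ε : ℝ) (z r : ℂ) : Prop := Fl ε z.re r.re ∧ Fl ε z.im r.im

/-- `r` is a possible computed value of `z + w`. -/
def FlAdd (ε : ℝ) (z w r : ℂ) : Prop := FlC ε (z + w) r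

/-- `r` is a possible computed value of `z * w`: four real products, one subtraction and one
addition. -/
def FlMul (ε : ℝ) (z w r : ℂ) : Prop :=
  ∃ a b c d : ℝ, Fl ε (z.re * w.re) a ∧ Fl ε (z.im * w.im) b ∧
    Fl ε (z.re * w.im) c ∧ Fl ε (z.im * w.re) d ∧ Fl ε (a - b) r.re ∧ Fl ε (c + d) r.im

/-- `r` is a possible computed value of `a * x + b * y`. -/
def FlLin (ε : ℝ) (a x b y r : ℂ) : Prop :=
  ∃ p q : ℂ, FlMul ε a x p ∧ FlMul ε b y q ∧ FlAdd ε p q r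

/-- Computed Givens rotation for the pair `(x, y)`: `r` is the computed Euclidean norm of
`(x, y)`, and `c`, `s` are the computed quotients `x / r`, `y / r`. In exact arithmetic the matrix
`G* = [[conj c, conj s], [-s, c]]` is unitary and maps `(x, y)` to `(r, 0)`; the identity is
used when `x = y = 0`. -/
def FlGivens (ε : ℝ) (x y c s : ℂ) (r : ℝ) : Prop :=
  (∃ a₁ a₂ a₃ a₄ b₁ b₂ h : ℝ,
    Fl ε (x.re * x.re) a₁ ∧ Fl ε (x.im * x.im) a₂ ∧
    Fl ε (y.re * y.re) a₃ ∧ Fl ε (y.im * y.im) a₄ ∧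
    Fl ε (a₁ + a₂) b₁ ∧ Fl ε (a₃ + a₄) b₂ ∧ Fl ε (b₁ + b₂) h ∧ Fl ε (√h) r) ∧
  ((r = 0 ∧ c = 1 ∧ s = 0) ∨ (r ≠ 0 ∧ FlC ε (x / r) c ∧ FlC ε (y / r) s))

/-- `x'` is a possible computed value of `G* x`, where `G* = [[conj c, conj s], [-s, c]]` acts on
the coordinates `k`, `k'`; the other coordinates are not touched. -/
def FlRot (ε : ℝ) {n : ℕ} (c s : ℂ) (k k' : Fin n) (x x' : Fin n → ℂ) : Prop :=
  FlLin ε (star c) (x k) (star s) (x k') (x' k) ∧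
  FlLin ε (-s) (x k) c (x k') (x' k') ∧
  ∀ i, i ≠ k → i ≠ k' → x' i = x i

/-- `W'` is a possible computed value of `G* W G`, with `G` as in `FlRot`:
first `G*` is applied to the columns of `W`, then `G` to the rows of the result. -/
def FlSim (ε : ℝ) {n : ℕ} (c s : ℂ) (k k' : Fin n) (W W' : Matrix (Fin n) (Fin n) ℂ) : Prop :=
  ∃ W₁ : Matrix (Fin n) (Fin n) ℂ,
    (∀ j, FlRot ε c s k k' (fun i => W i j) (fun i => W₁ i j)) ∧
    (∀ i, FlRot ε (star c) (star s) k k' (W₁ i) (W' i))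

/-! ### The structured representation -/

/-- The data stored by the structured QR iteration for a Hermitian-plus-rank-one matrix:
the lower triangular part of the matrix and the vectors `u`, `v`. Only `low i j` with `j ≤ i`
is meaningful: `low i i = dᵢ` is the diagonal, `low (i+1) i = βᵢ` the subdiagonal, and the
entries below the subdiagonal are zero, except for the few that are stored temporarily
(bulges, and the spike of an aggressive early deflation). -/
structure Generators (n : ℕ) where
  low : Matrix (Fin n) (Fin n) ℂ
  u : Fin n → ℂ
  v : Fin n → ℂ

/-- The matrix determined by the generators. Above the diagonal the entries follow from the lower
part because `A - u v*` is Hermitian; for `i + 1 < j` and `low j i = 0` this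
is `uᵢ conj(vⱼ) - conj(uⱼ) vᵢ`. -/
def Generators.toMatrix {n : ℕ} (R : Generators n) : Matrix (Fin n) (Fin n) ℂ := fun i j =>
  if j ≤ i then R.low i j
  else star (R.low j i) - star (R.u j) * R.v i + R.u i * star (R.v j)

/-- `W` is a possible result of evaluating in floating point the entries of the matrix determined
by the generators `R`. (A bulge-chasing step reads only the entries of `W` in a few rows and
columns next to the diagonal; the other entries above the diagonal are never used by it.) -/
def FlMatrix (ε : ℝ) {n : ℕ} (R : Generators n) (W : Matrix (Fin n) (Fin n) ℂ) : Prop :=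
  (∀ i j, j ≤ i → W i j = R.low i j) ∧
  ∀ i j, i < j → ∃ a b t : ℂ,
    FlMul ε (star (R.u j)) (R.v i) a ∧ FlAdd ε (star (R.low j i)) (-a) t ∧
    FlMul ε (R.u i) (star (R.v j)) b ∧ FlAdd ε t b (W i j)

/-- The generators `R` are those of `A = F + u v*`, each entry rounded when it is stored. -/
def Stores (ε : ℝ) {n : ℕ} (A : Matrix (Fin n) (Fin n) ℂ) (u v : Fin n → ℂ)
    (R : Generators n) : Prop :=
  (∀ i j, j ≤ i → FlC ε (A i j) (R.low i j)) ∧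
  (∀ i, FlC ε (u i) (R.u i)) ∧ ∀ i, FlC ε (v i) (R.v i)

/-! ### The structured QR iteration -/

/-- One elementary step of the structured QR iteration, in floating point arithmetic with unit
roundoff `ε`. The choice of shifts and the order of the steps are left free, so that every
shift strategy, every deflation schedule (with or without aggressive early
deflation) and every interleaving of several bulges is covered.

* `startSingle`: a single-shift bulge is created by the rotation in the plane `(k, k+1)` computed
  from a vector `(x, y)` (the computed value of `(d_k - σ, β_k)` for the current shift `σ`).
* `chaseSingle`: the rotation in the plane `(k, k+1)` that annihilates the entry `(k+1, m)` against
  the entry `(k, m)`. For `m = k - 1` this is the single-shift bulge chasing step; for the spike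
  column `m` it is a step of the reduction to Hessenberg form after an aggressive early deflation.
* `startDouble`, `chaseDouble`: the same with two rotations, in the planes `(k+1, k+2)` and
  `(k, k+1)`, that reduce a vector of three entries; both are applied to the same block, evaluated
  once from the generators.
* `deflate`: a negligible stored entry below the diagonal is replaced by zero. The condition is
  implied by each of the criteria `|a i j| ≤ ε (|a i i| + |a j j|)`, `|a i j| ≤ ε |a i i|`
  and `|a i j| ≤ ε ‖A‖`.

After the rotations only the lower triangular part of the updated entries is kept, and `u`, `v` are
updated by the same rotations. -/
inductive QRStep (ε : ℝ) {n : ℕ} (R R' : Generators n) : Prop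
  | startSingle (k k' : Fin n) (hk : (k' : ℕ) = k + 1) (x y c s : ℂ) (r : ℝ)
      (W W' : Matrix (Fin n) (Fin n) ℂ)
      (hG : FlGivens ε x y c s r)
      (hW : FlMatrix ε R W) (hW' : FlSim ε c s k k' W W')
      (hlow : ∀ i j, j ≤ i → R'.low i j = W' i j)
      (hu : FlRot ε c s k k' R.u R'.u) (hv : FlRot ε c s k k' R.v R'.v)
  | chaseSingle (k k' m : Fin n) (hk : (k' : ℕ) = k + 1) (hm : m < k) (c s : ℂ) (r : ℝ)
      (W W' : Matrix (Fin n) (Fin n) ℂ)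
      (hG : FlGivens ε (R.low k m) (R.low k' m) c s r)
      (hW : FlMatrix ε R W) (hW' : FlSim ε c s k k' W W')
      (hlow : ∀ i j, j ≤ i → R'.low i j =
        if j = m ∧ i = k then (r : ℂ) else if j = m ∧ i = k' then 0 else W' i j)
      (hu : FlRot ε c s k k' R.u R'.u) (hv : FlRot ε c s k k' R.v R'.v)
  | startDouble (k k' k'' : Fin n) (hk : (k' : ℕ) = k + 1) (hk' : (k'' : ℕ) = k + 2)
      (x y z c₁ s₁ c₂ s₂ : ℂ) (r₁ r₂ : ℝ)
      (W W₁ W' : Matrix (Fin n) (Fin n) ℂ) (u₁ v₁ : Fin n → ℂ)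
      (hG₂ : FlGivens ε y z c₂ s₂ r₂) (hG₁ : FlGivens ε x r₂ c₁ s₁ r₁)
      (hW : FlMatrix ε R W) (hW₁ : FlSim ε c₂ s₂ k' k'' W W₁) (hW' : FlSim ε c₁ s₁ k k' W₁ W')
      (hlow : ∀ i j, j ≤ i → R'.low i j = W' i j)
      (hu₁ : FlRot ε c₂ s₂ k' k'' R.u u₁) (hu : FlRot ε c₁ s₁ k k' u₁ R'.u)
      (hv₁ : FlRot ε c₂ s₂ k' k'' R.v v₁) (hv : FlRot ε c₁ s₁ k k' v₁ R'.v)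
  | chaseDouble (k k' k'' m : Fin n) (hk : (k' : ℕ) = k + 1) (hk' : (k'' : ℕ) = k + 2)
      (hm : m < k) (c₁ s₁ c₂ s₂ : ℂ) (r₁ r₂ : ℝ)
      (W W₁ W' : Matrix (Fin n) (Fin n) ℂ) (u₁ v₁ : Fin n → ℂ)
      (hG₂ : FlGivens ε (R.low k' m) (R.low k'' m) c₂ s₂ r₂)
      (hG₁ : FlGivens ε (R.low k m) r₂ c₁ s₁ r₁)
      (hW : FlMatrix ε R W) (hW₁ : FlSim ε c₂ s₂ k' k'' W W₁) (hW' : FlSim ε c₁ s₁ k k' W₁ W')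
      (hlow : ∀ i j, j ≤ i → R'.low i j =
        if j = m ∧ i = k then (r₁ : ℂ) else if j = m ∧ (i = k' ∨ i = k'') then 0 else W' i j)
      (hu₁ : FlRot ε c₂ s₂ k' k'' R.u u₁) (hu : FlRot ε c₁ s₁ k k' u₁ R'.u)
      (hv₁ : FlRot ε c₂ s₂ k' k'' R.v v₁) (hv : FlRot ε c₁ s₁ k k' v₁ R'.v)
  | deflate (k m : Fin n) (hm : m < k)
      (hsmall : ‖R.low k m‖ ≤ 2 * ε * ‖R.toMatrix‖)
      (hlow : ∀ i j, j ≤ i → R'.low i j = if i = k ∧ j = m then 0 else R.low i j)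
      (hu : R'.u = R.u) (hv : R'.v = R.v)

/-- `QRRun ε N R R'`: some `N` elementary steps lead from the generators `R` to `R'`. -/
inductive QRRun (ε : ℝ) {n : ℕ} : ℕ → Generators n → Generators n → Prop
  | refl (R : Generators n) : QRRun ε 0 R R
  | step {N : ℕ} {R R' R'' : Generators n} (h : QRRun ε N R R') (hs : QRStep ε R' R'') :
      QRRun ε (N + 1) R R''

/-- `T` is an approximate Schur form computed by `N` elementary steps of the structured QR iteration
from the matrix `A`, given as a Hermitian matrix plus `u v*`: the generators of `A` are
stored, the steps are performed, all entries below the diagonal have become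
zero, and `T` is the (upper triangular) matrix evaluated from the final generators. -/
def ComputedSchurForm (ε : ℝ) {n : ℕ} (A : Matrix (Fin n) (Fin n) ℂ) (u v : Fin n → ℂ) (N : ℕ)
    (T : Matrix (Fin n) (Fin n) ℂ) : Prop :=
  ∃ R₀ R : Generators n, Stores ε A u v R₀ ∧ QRRun ε N R₀ R ∧
    (∀ i j, j < i → R.low i j = 0) ∧ FlMatrix ε R T

end

/-! ### Elementary rounding error bounds -/

/-! Each elementary step is an exact unitary similarity up to an error `O(ε)`, and these errors are
summed. A computed rotation is close to a unitary one that annihilates the same component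
(`FlGivens.exists_exact`). Hence the new lower triangle, entrywise, and the new vectors, in norm,
are close to the exact transforms (`QRStep.exists_nearSim`).

The delicate point is the upper triangle, which is not updated but rebuilt by a formula that is
exact only when `A - u v*` is Hermitian. Rounding destroys this, so the defect `K = (A - u v*) - (A
- u v*)*` is tracked as well. A unitary similarity conjugates `K` and preserves its norm. Moreover
the matrix rebuilt from generators has a diagonal defect, so its norm is the largest modulus of an
entry and no factor `n` is lost; such a factor would compound from step to step. Thus `K` grows
additively, by `O(ε S)` per step, where `S` bounds `‖A‖` and `‖u‖ ‖v‖`. In step `m` the rebuilt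
matrix is off by `O(m ε S)` entrywise and `n` times that in norm; summed over `N` steps this is of
order `n N² ε S` (`AccumulatedError.succ`).

For the colleague matrix `‖u‖ ‖v‖ ≤ 3 ‖A‖`, because `v` can be read off the first row of `A`. So `S
= 3 ‖A‖`, and `N ≤ q(n)` gives a polynomial of degree at most `2 deg q + 1`. -/

theorem Fl.abs_sub_le {ε x r B : ℝ} (hε : 0 ≤ ε) (h : Fl ε x r) (hB : |x| ≤ B) :
    |r - x| ≤ ε * B :=
  h.trans (mul_le_mul_of_nonneg_left hB hε)

theorem Fl.abs_sub_le_of_approx {ε x y r B δ : ℝ} (hε : 0 ≤ ε) (hε1 : ε ≤ 1) (h : Fl ε x r)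
    (hB : |y| ≤ B) (hxy : |x - y| ≤ δ) : |r - y| ≤ ε * B + 2 * δ := by
  have h1 : |x| ≤ B + δ := by
    calc |x| = |y + (x - y)| := by ring_nf
      _ ≤ |y| + |x - y| := abs_add_le _ _
      _ ≤ B + δ := by linarith
  have hδ : 0 ≤ δ := (abs_nonneg _).trans hxy
  calc |r - y| = |(r - x) + (x - y)| := by ring_nf
    _ ≤ |r - x| + |x - y| := abs_add_le _ _
    _ ≤ ε * (B + δ) + δ := add_le_add (h.abs_sub_le hε h1) hxy
    _ ≤ ε * B + 2 * δ := by nlinarith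

theorem Complex.norm_le_two_mul {z : ℂ} {δ : ℝ} (h₁ : |z.re| ≤ δ) (h₂ : |z.im| ≤ δ) :
    ‖z‖ ≤ 2 * δ :=
  (Complex.norm_le_abs_re_add_abs_im z).trans (by linarith)

theorem FlC.norm_sub_le {ε : ℝ} {z r : ℂ} (hε : 0 ≤ ε) (h : FlC ε z r) :
    ‖r - z‖ ≤ 2 * ε * ‖z‖ := by
  rw [mul_assoc]
  refine Complex.norm_le_two_mul ?_ ?_
  · rw [Complex.sub_re]
    exact h.1.abs_sub_le hε (Complex.abs_re_le_norm z)
  · rw [Complex.sub_im]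
    exact h.2.abs_sub_le hε (Complex.abs_im_le_norm z)

theorem FlC.norm_sub_le_of_approx {ε B δ : ℝ} {x y r : ℂ} (hε : 0 ≤ ε) (hε1 : ε ≤ 1)
    (h : FlC ε x r) (hB : ‖y‖ ≤ B) (hxy : ‖x - y‖ ≤ δ) : ‖r - y‖ ≤ 2 * ε * B + 3 * δ := by
  have h1 : ‖x‖ ≤ B + δ := by
    calc ‖x‖ = ‖y + (x - y)‖ := by ring_nf
      _ ≤ ‖y‖ + ‖x - y‖ := norm_add_le _ _
      _ ≤ B + δ := by linarith
  have hδ : 0 ≤ δ := (norm_nonneg _).trans hxy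
  calc ‖r - y‖ = ‖(r - x) + (x - y)‖ := by ring_nf
    _ ≤ ‖r - x‖ + ‖x - y‖ := norm_add_le _ _
    _ ≤ 2 * ε * (B + δ) + δ := by
        refine add_le_add ((h.norm_sub_le hε).trans ?_) hxy
        gcongr
    _ ≤ 2 * ε * B + 3 * δ := by nlinarith

/-- Cancellation can occur in the real or imaginary part, so the error is measured against the
product of the moduli. Each part costs `2 + 2 · 2 = 6` units, both together 12. -/
theorem FlMul.norm_sub_le {ε : ℝ} {z w r : ℂ} (hε : 0 ≤ ε) (hε1 : ε ≤ 1) (h : FlMul ε z w r) :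
    ‖r - z * w‖ ≤ 12 * ε * (‖z‖ * ‖w‖) := by
  obtain ⟨a, b, c, d, ha, hb, hc, hd, hre, him⟩ := h
  have hz1 := Complex.abs_re_le_norm z
  have hz2 := Complex.abs_im_le_norm z
  have hw1 := Complex.abs_re_le_norm w
  have hw2 := Complex.abs_im_le_norm w
  set p := ‖z‖ * ‖w‖ with hp
  have key : ∀ s t : ℝ, |s| ≤ ‖z‖ → |t| ≤ ‖w‖ → |s * t| ≤ p := fun s t hs ht => by
    rw [abs_mul]
    exact mul_le_mul hs ht (abs_nonneg _) (norm_nonneg _)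
  have e1 := ha.abs_sub_le hε (key _ _ hz1 hw1)
  have e2 := hb.abs_sub_le hε (key _ _ hz2 hw2)
  have e3 := hc.abs_sub_le hε (key _ _ hz1 hw2)
  have e4 := hd.abs_sub_le hε (key _ _ hz2 hw1)
  have k1 := key _ _ hz1 hw1
  have k2 := key _ _ hz2 hw2
  have k3 := key _ _ hz1 hw2
  have k4 := key _ _ hz2 hw1
  have := Complex.norm_le_two_mul (z := r - z * w) (δ := ε * (2 * p) + 2 * (2 * (ε * p))) ?_ ?_
  · linarith
  · rw [Complex.sub_re, Complex.mul_re]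
    refine hre.abs_sub_le_of_approx hε hε1 ?_ ?_
    · exact (abs_sub _ _).trans (by linarith)
    · rw [show a - b - (z.re * w.re - z.im * w.im) = (a - z.re * w.re) - (b - z.im * w.im) by ring]
      exact (abs_sub _ _).trans (by linarith)
  · rw [Complex.sub_im, Complex.mul_im]
    refine him.abs_sub_le_of_approx hε hε1 ?_ ?_
    · exact (abs_add_le _ _).trans (by linarith)
    · rw [show c + d - (z.re * w.im + z.im * w.re) = (c - z.re * w.im) + (d - z.im * w.re) by ring]
      exact (abs_add_le _ _).trans (by linarith)

theorem FlAdd.norm_sub_le_of_approx {ε B δ : ℝ} {x x' y y' r : ℂ} (hε : 0 ≤ ε) (hε1 : ε ≤ 1)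
    (h : FlAdd ε x' y' r) (hB : ‖x‖ + ‖y‖ ≤ B) (hxy : ‖x' - x‖ + ‖y' - y‖ ≤ δ) :
    ‖r - (x + y)‖ ≤ 2 * ε * B + 3 * δ := by
  refine FlC.norm_sub_le_of_approx hε hε1 h ((norm_add_le _ _).trans hB) ?_
  rw [show x' + y' - (x + y) = (x' - x) + (y' - y) by ring]
  exact (norm_add_le _ _).trans hxy

theorem FlLin.norm_sub_le {ε : ℝ} {a x b y r : ℂ} (hε : 0 ≤ ε) (hε1 : ε ≤ 1)
    (h : FlLin ε a x b y r) :
    ‖r - (a * x + b * y)‖ ≤ 38 * ε * (‖a‖ * ‖x‖ + ‖b‖ * ‖y‖) := by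
  obtain ⟨p, q, hp, hq, hr⟩ := h
  have := hr.norm_sub_le_of_approx hε hε1 (x := a * x) (y := b * y)
    (B := ‖a‖ * ‖x‖ + ‖b‖ * ‖y‖) (by simp)
    (add_le_add (hp.norm_sub_le hε hε1) (hq.norm_sub_le hε hε1))
  linarith

/-- A linear combination computed with perturbed coefficients of modulus about `1`. -/
theorem FlLin.norm_sub_le_of_approx {ε γ : ℝ} {a a₀ x b b₀ y r : ℂ} (hε : 0 ≤ ε)
    (hγ : γ * ε ≤ 1) (hε1 : ε ≤ 1) (h : FlLin ε a x b y r) (ha₀ : ‖a₀‖ ≤ 1) (hb₀ : ‖b₀‖ ≤ 1)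
    (ha : ‖a - a₀‖ ≤ γ * ε) (hb : ‖b - b₀‖ ≤ γ * ε) :
    ‖r - (a₀ * x + b₀ * y)‖ ≤ (76 + γ) * ε * (‖x‖ + ‖y‖) := by
  have h1 := h.norm_sub_le hε hε1
  have na : ‖a‖ ≤ 2 := by
    calc ‖a‖ = ‖a₀ + (a - a₀)‖ := by ring_nf
      _ ≤ ‖a₀‖ + ‖a - a₀‖ := norm_add_le _ _
      _ ≤ 2 := by linarith
  have nb : ‖b‖ ≤ 2 := by
    calc ‖b‖ = ‖b₀ + (b - b₀)‖ := by ring_nf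
      _ ≤ ‖b₀‖ + ‖b - b₀‖ := norm_add_le _ _
      _ ≤ 2 := by linarith
  have h2 : ‖a * x + b * y - (a₀ * x + b₀ * y)‖ ≤ γ * ε * (‖x‖ + ‖y‖) := by
    rw [show a * x + b * y - (a₀ * x + b₀ * y) = (a - a₀) * x + (b - b₀) * y by ring, mul_add]
    refine (norm_add_le _ _).trans ?_
    rw [norm_mul, norm_mul]
    gcongr
  calc ‖r - (a₀ * x + b₀ * y)‖
      = ‖(r - (a * x + b * y)) + (a * x + b * y - (a₀ * x + b₀ * y))‖ := by ring_nf
    _ ≤ 38 * ε * (‖a‖ * ‖x‖ + ‖b‖ * ‖y‖) + γ * ε * (‖x‖ + ‖y‖) :=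
        (norm_add_le _ _).trans (add_le_add h1 h2)
    _ ≤ 38 * ε * (2 * ‖x‖ + 2 * ‖y‖) + γ * ε * (‖x‖ + ‖y‖) := by gcongr
    _ = _ := by ring

/-! ### Givens rotations -/

/-- The computed norm of a pair of complex numbers is accurate. -/
theorem abs_norm_sub_le_of_flGivens {ε t₁ t₂ t₃ t₄ a₁ a₂ a₃ a₄ b₁ b₂ h r : ℝ} (hε : 0 ≤ ε)
    (hε1 : ε ≤ 1) (ht₁ : 0 ≤ t₁) (ht₂ : 0 ≤ t₂) (ht₃ : 0 ≤ t₃) (ht₄ : 0 ≤ t₄)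
    (h₁ : Fl ε t₁ a₁) (h₂ : Fl ε t₂ a₂) (h₃ : Fl ε t₃ a₃) (h₄ : Fl ε t₄ a₄)
    (hb₁ : Fl ε (a₁ + a₂) b₁) (hb₂ : Fl ε (a₃ + a₄) b₂) (hh : Fl ε (b₁ + b₂) h)
    (hr : Fl ε (√h) r) :
    |r - √(t₁ + t₂ + t₃ + t₄)| ≤ 15 * ε * √(t₁ + t₂ + t₃ + t₄) := by
  set t := t₁ + t₂ + t₃ + t₄ with ht
  have ht0 : 0 ≤ t := by positivity
  have e₁ := h₁.abs_sub_le hε (abs_of_nonneg ht₁).le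
  have e₂ := h₂.abs_sub_le hε (abs_of_nonneg ht₂).le
  have e₃ := h₃.abs_sub_le hε (abs_of_nonneg ht₃).le
  have e₄ := h₄.abs_sub_le hε (abs_of_nonneg ht₄).le
  have f₁ : |b₁ - (t₁ + t₂)| ≤ ε * (t₁ + t₂) + 2 * (ε * (t₁ + t₂)) := by
    refine hb₁.abs_sub_le_of_approx hε hε1 (abs_of_nonneg (by positivity)).le ?_
    rw [show a₁ + a₂ - (t₁ + t₂) = (a₁ - t₁) + (a₂ - t₂) by ring]
    exact (abs_add_le _ _).trans (by linarith)
  have f₂ : |b₂ - (t₃ + t₄)| ≤ ε * (t₃ + t₄) + 2 * (ε * (t₃ + t₄)) := by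
    refine hb₂.abs_sub_le_of_approx hε hε1 (abs_of_nonneg (by positivity)).le ?_
    rw [show a₃ + a₄ - (t₃ + t₄) = (a₃ - t₃) + (a₄ - t₄) by ring]
    exact (abs_add_le _ _).trans (by linarith)
  have g : |h - t| ≤ ε * t + 2 * (3 * (ε * t)) := by
    refine hh.abs_sub_le_of_approx hε hε1 (abs_of_nonneg ht0).le ?_
    rw [show b₁ + b₂ - t = (b₁ - (t₁ + t₂)) + (b₂ - (t₃ + t₄)) by rw [ht]; ring]
    exact (abs_add_le _ _).trans (by rw [ht]; linarith)
  -- The difference of the roots is `(h - t) / (√h + √t)`, with denominator at least `√t`. A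
  -- negative `h` is possible only if `7ε ≥ 1`, and then the bound is trivial.
  have k : |√h - √t| ≤ 7 * ε * √t := by
    rcases ht0.eq_or_lt with h0 | hpos
    · rw [← h0] at g ⊢
      have : h = 0 := by simpa using g
      simp [this]
    · have hs : 0 < √t := Real.sqrt_pos.2 hpos
      have hst : √t * √t = t := Real.mul_self_sqrt ht0
      rcases le_or_gt 0 h with hh0 | hh0
      · have : |√h - √t| * √t ≤ |h - t| := by
          have e : h - t = (√h - √t) * (√h + √t) := by
            have := Real.mul_self_sqrt hh0
            nlinarith
          rw [e, abs_mul]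
          gcongr
          rw [abs_of_nonneg (by positivity)]
          linarith [Real.sqrt_nonneg h]
        have h2 : |√h - √t| * √t ≤ (7 * ε * √t) * √t := by
          calc _ ≤ |h - t| := this
            _ ≤ 7 * ε * t := by linarith
            _ = _ := by rw [← hst]; ring_nf; simp [Real.sqrt_sq]
        exact le_of_mul_le_mul_right h2 hs
      · rw [Real.sqrt_eq_zero_of_nonpos hh0.le, zero_sub, abs_neg, abs_of_pos hs]
        have : t ≤ 7 * ε * t := by
          have := neg_abs_le (h - t)
          linarith
        have : 1 ≤ 7 * ε := by
          by_contra hc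
          push Not at hc
          nlinarith
        nlinarith
  have := hr.abs_sub_le_of_approx hε hε1 (abs_of_nonneg (Real.sqrt_nonneg t)).le k
  linarith

/-- A computed Givens rotation is close to an exact unitary one that annihilates `y` exactly. -/
theorem FlGivens.exists_exact {ε r : ℝ} {x y c s : ℂ} (hε : 0 ≤ ε) (hε1 : 30 * ε ≤ 1)
    (h : FlGivens ε x y c s r) :
    ∃ c₀ s₀ : ℂ, ‖c₀‖ ^ 2 + ‖s₀‖ ^ 2 = 1 ∧ ‖c - c₀‖ ≤ 34 * ε ∧ ‖s - s₀‖ ≤ 34 * ε ∧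
      ‖star c₀ * x + star s₀ * y - r‖ ≤ 15 * ε * (‖x‖ + ‖y‖) ∧ -s₀ * x + c₀ * y = 0 := by
  obtain ⟨⟨a₁, a₂, a₃, a₄, b₁, b₂, h, h₁, h₂, h₃, h₄, hb₁, hb₂, hh, hr⟩, hcs⟩ := h
  have key := abs_norm_sub_le_of_flGivens hε (by linarith) (mul_self_nonneg _) (mul_self_nonneg _)
    (mul_self_nonneg _) (mul_self_nonneg _) h₁ h₂ h₃ h₄ hb₁ hb₂ hh hr
  have hT : x.re * x.re + x.im * x.im + y.re * y.re + y.im * y.im = ‖x‖ ^ 2 + ‖y‖ ^ 2 := by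
    rw [Complex.sq_norm, Complex.sq_norm, Complex.normSq_apply, Complex.normSq_apply]
    ring
  rw [hT] at key
  set ρ := √(‖x‖ ^ 2 + ‖y‖ ^ 2) with hρ
  have hρ0 : 0 ≤ ρ := Real.sqrt_nonneg _
  have hρ2 : ρ ^ 2 = ‖x‖ ^ 2 + ‖y‖ ^ 2 := Real.sq_sqrt (by positivity)
  have hx : ‖x‖ ≤ ρ := abs_le_of_sq_le_sq' (by nlinarith [sq_nonneg ‖y‖]) hρ0 |>.2
  have hy : ‖y‖ ≤ ρ := abs_le_of_sq_le_sq' (by nlinarith [sq_nonneg ‖x‖]) hρ0 |>.2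
  have hρle : ρ ≤ ‖x‖ + ‖y‖ := by
    refine abs_le_of_sq_le_sq' ?_ (by positivity) |>.2
    nlinarith [mul_nonneg (norm_nonneg x) (norm_nonneg y)]
  rcases hρ0.eq_or_lt with h0 | hpos
  · rw [← h0] at key hx hy
    have hr0 : r = 0 := by simpa using key
    have hx0 : x = 0 := by simpa using hx
    have hy0 : y = 0 := by simpa using hy
    rcases hcs with ⟨_, hc, hs⟩ | ⟨hne, _⟩
    · refine ⟨1, 0, by simp, ?_, ?_, ?_, ?_⟩
      · simpa [hc] using hε
      · simpa [hs] using hε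
      · simp [hx0, hy0, hr0]
      · simp [hx0, hy0]
    · exact absurd hr0 hne
  -- Since `15ε ≤ 1/2`, the computed norm is at least half the exact one and the quotients by `r`
  -- have modulus at most 2. This gives `2 · 2 + 2 · 15 = 34` below.
  · have hrρ : ρ / 2 ≤ r := by
      have := neg_abs_le (r - ρ)
      nlinarith
    have hrpos : 0 < r := by linarith
    rcases hcs with ⟨hr0, _⟩ | ⟨-, hc, hs⟩
    · exact absurd hr0 hrpos.ne'
    have hρC : (ρ : ℂ) ≠ 0 := by exact_mod_cast hpos.ne'
    have hrC : (r : ℂ) ≠ 0 := by exact_mod_cast hrpos.ne'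
    have quot : ∀ {w d : ℂ}, ‖w‖ ≤ ρ → FlC ε (w / r) d → ‖d - w / ρ‖ ≤ 34 * ε := by
      intro w d hw hd
      have n1 : ‖w / r‖ ≤ 2 := by
        rw [norm_div, Complex.norm_of_nonneg hrpos.le, div_le_iff₀ hrpos]
        linarith
      have n2 : ‖w / r - w / ρ‖ ≤ 30 * ε := by
        have e : w / r - w / ρ = (w / r) * ((ρ - r : ℝ) / ρ) := by
          push_cast
          field_simp
        rw [e, norm_mul (w / r), norm_div ((ρ - r : ℝ) : ℂ) ρ, Complex.norm_real, Complex.norm_real, Real.norm_eq_abs,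
          Real.norm_eq_abs, abs_sub_comm, abs_of_pos hpos]
        have : |r - ρ| / ρ ≤ 15 * ε := by
          rw [div_le_iff₀ hpos]
          exact key
        calc ‖w / r‖ * (|r - ρ| / ρ) ≤ 2 * (15 * ε) := by gcongr
          _ = _ := by ring
      calc ‖d - w / ρ‖ = ‖(d - w / r) + (w / r - w / ρ)‖ := by ring_nf
        _ ≤ 2 * ε * ‖w / r‖ + 30 * ε := (norm_add_le _ _).trans (add_le_add (hd.norm_sub_le hε) n2)
        _ ≤ 2 * ε * 2 + 30 * ε := by gcongr
        _ = _ := by ring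
    refine ⟨x / ρ, y / ρ, ?_, quot hx hc, quot hy hs, ?_, ?_⟩
    · rw [norm_div, norm_div, Complex.norm_of_nonneg hρ0, div_pow, div_pow, ← add_div, ← hρ2,
        div_self (by positivity)]
    · have e : star (x / ρ) * x + star (y / ρ) * y = (ρ : ℂ) := by
        have ex : star x * x = ((‖x‖ ^ 2 : ℝ) : ℂ) := by
          push_cast
          exact Complex.conj_mul' x
        have ey : star y * y = ((‖y‖ ^ 2 : ℝ) : ℂ) := by
          push_cast
          exact Complex.conj_mul' y
        have eρ : star (ρ : ℂ) = ρ := Complex.conj_ofReal ρ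
        rw [star_div₀, star_div₀, eρ, div_mul_eq_mul_div, div_mul_eq_mul_div, ← add_div, ex, ey,
          ← Complex.ofReal_add, ← hρ2, Complex.ofReal_pow, sq, mul_div_assoc, div_self hρC, mul_one]
      rw [e, ← Complex.ofReal_sub, Complex.norm_real, Real.norm_eq_abs, abs_sub_comm]
      exact key.trans (by gcongr)
    · field_simp
      ring

/-- The matrix `G* = [[conj c, conj s], [-s, c]]`, acting on the coordinates `k`, `k'`. -/
noncomputable def givensMatrix {n : ℕ} (c s : ℂ) (k k' : Fin n) : Matrix (Fin n) (Fin n) ℂ :=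
  fun i =>
    if i = k then Pi.single k (star c) + Pi.single k' (star s)
    else if i = k' then Pi.single k (-s) + Pi.single k' c
    else Pi.single i 1

section Givens

variable {n : ℕ} {c s : ℂ} {k k' : Fin n}

theorem givensMatrix_mulVec_fst (x : Fin n → ℂ) :
    (givensMatrix c s k k' *ᵥ x) k = star c * x k + star s * x k' := by
  have h : givensMatrix c s k k' k = Pi.single k (star c) + Pi.single k' (star s) := if_pos rfl
  rw [Matrix.mulVec, h, add_dotProduct, single_dotProduct, single_dotProduct]

theorem givensMatrix_mulVec_snd (hk : k ≠ k') (x : Fin n → ℂ) :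
    (givensMatrix c s k k' *ᵥ x) k' = -s * x k + c * x k' := by
  have h : givensMatrix c s k k' k' = Pi.single k (-s) + Pi.single k' c := by
    simp [givensMatrix, hk.symm]
  rw [Matrix.mulVec, h, add_dotProduct, single_dotProduct, single_dotProduct]

theorem givensMatrix_mulVec_of_ne {i : Fin n} (h : i ≠ k) (h' : i ≠ k') (x : Fin n → ℂ) :
    (givensMatrix c s k k' *ᵥ x) i = x i := by
  simp [givensMatrix, Matrix.mulVec, h, h']

theorem givensMatrix_mem_unitaryGroup (hk : k ≠ k') (hcs : ‖c‖ ^ 2 + ‖s‖ ^ 2 = 1) :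
    givensMatrix c s k k' ∈ Matrix.unitaryGroup (Fin n) ℂ := by
  have h1 : star c * c + star s * s = 1 := by
    have hc : star c * c = ((‖c‖ ^ 2 : ℝ) : ℂ) := by
      push_cast
      exact Complex.conj_mul' c
    have hs : star s * s = ((‖s‖ ^ 2 : ℝ) : ℂ) := by
      push_cast
      exact Complex.conj_mul' s
    rw [hc, hs, ← Complex.ofReal_add, hcs, Complex.ofReal_one]
  rw [Matrix.mem_unitaryGroup_iff, Matrix.star_eq_conjTranspose]
  have entry : ∀ i j, (givensMatrix c s k k' * (givensMatrix c s k k')ᴴ) i j =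
      (givensMatrix c s k k' *ᵥ fun l => star (givensMatrix c s k k' j l)) i := fun i j => rfl
  ext i j
  rw [entry]
  by_cases hi : i = k
  · subst hi
    rw [givensMatrix_mulVec_fst]
    by_cases hj : j = i
    · subst hj
      simp [givensMatrix, hk, hk.symm]
      simpa using h1
    by_cases hj' : j = k'
    · subst hj'
      simp [givensMatrix, hk, hk.symm]
      ring
    · simp [givensMatrix, hj, hj', Ne.symm hj, Ne.symm hj']
  by_cases hi' : i = k'
  · subst hi'
    rw [givensMatrix_mulVec_snd hk]
    by_cases hj : j = k
    · subst hj
      simp [givensMatrix, hk, hk.symm]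
      ring
    by_cases hj' : j = i
    · subst hj'
      simp [givensMatrix, hk, hk.symm]
      simp only [Complex.star_def] at h1
      linear_combination h1
    · simp [givensMatrix, hj, hj', Ne.symm hj, Ne.symm hj']
  · rw [givensMatrix_mulVec_of_ne hi hi']
    by_cases hj : j = k
    · subst hj
      simp [givensMatrix, hi, hi']
    by_cases hj' : j = k'
    · subst hj'
      simp [givensMatrix, hk.symm, hi, hi']
    · simp only [givensMatrix, hj, hj', if_false, Pi.single_apply, Matrix.one_apply]
      split_ifs <;> simp

/-- Rotating from the right is rotating each row from the left with conjugated coefficients, so the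
bounds for rotated vectors serve both halves of a similarity. -/
theorem mul_givensMatrix_conjTranspose_apply (hk : k ≠ k') (M : Matrix (Fin n) (Fin n) ℂ)
    (i j : Fin n) :
    (M * (givensMatrix c s k k')ᴴ) i j = (givensMatrix (star c) (star s) k k' *ᵥ M i) j := by
  have : (M * (givensMatrix c s k k')ᴴ) i j =
      star ((givensMatrix c s k k' *ᵥ fun l => star (M i l)) j) := by
    simp only [Matrix.mul_apply, Matrix.conjTranspose_apply, Matrix.mulVec, dotProduct, star_sum,
      star_mul', star_star]
    exact Finset.sum_congr rfl fun _ _ => mul_comm _ _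
  rw [this]
  by_cases hj : j = k
  · subst hj
    simp [givensMatrix_mulVec_fst]
  by_cases hj' : j = k'
  · subst hj'
    simp [givensMatrix_mulVec_snd hk]
  · simp [givensMatrix_mulVec_of_ne hj hj']

theorem norm_fst_le_one (hcs : ‖c‖ ^ 2 + ‖s‖ ^ 2 = 1) : ‖c‖ ≤ 1 := by
  refine (sq_le_one_iff₀ (norm_nonneg c)).1 ?_
  linarith [sq_nonneg ‖s‖]

theorem norm_snd_le_one (hcs : ‖c‖ ^ 2 + ‖s‖ ^ 2 = 1) : ‖s‖ ≤ 1 := by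
  rw [add_comm] at hcs
  exact norm_fst_le_one hcs

theorem norm_givensMatrix_mulVec_le (hk : k ≠ k') (hcs : ‖c‖ ^ 2 + ‖s‖ ^ 2 = 1) {x : Fin n → ℂ}
    {B : ℝ} (hx : ∀ i, ‖x i‖ ≤ B) (i : Fin n) : ‖(givensMatrix c s k k' *ᵥ x) i‖ ≤ 2 * B := by
  have hc := norm_fst_le_one hcs
  have hs := norm_snd_le_one hcs
  have hB : 0 ≤ B := (norm_nonneg _).trans (hx k)
  by_cases hi : i = k
  · subst hi
    rw [givensMatrix_mulVec_fst]
    refine (norm_add_le _ _).trans ?_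
    rw [norm_mul, norm_mul, norm_star, norm_star]
    nlinarith [mul_le_mul hc (hx i) (norm_nonneg _) zero_le_one,
      mul_le_mul hs (hx k') (norm_nonneg _) zero_le_one]
  by_cases hi' : i = k'
  · subst hi'
    rw [givensMatrix_mulVec_snd hk]
    refine (norm_add_le _ _).trans ?_
    rw [norm_mul, norm_mul, norm_neg]
    nlinarith [mul_le_mul hc (hx i) (norm_nonneg _) zero_le_one,
      mul_le_mul hs (hx k) (norm_nonneg _) zero_le_one]
  · rw [givensMatrix_mulVec_of_ne hi hi']
    linarith [hx i]

theorem norm_givensMatrix_conj_le (hk : k ≠ k') (hcs : ‖c‖ ^ 2 + ‖s‖ ^ 2 = 1)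
    {E : Matrix (Fin n) (Fin n) ℂ} {B : ℝ} (hE : ∀ i j, ‖E i j‖ ≤ B) (i j : Fin n) :
    ‖(givensMatrix c s k k' * E * (givensMatrix c s k k')ᴴ) i j‖ ≤ 4 * B := by
  rw [mul_givensMatrix_conjTranspose_apply hk]
  have h : ‖star c‖ ^ 2 + ‖star s‖ ^ 2 = 1 := by rwa [norm_star, norm_star]
  have := norm_givensMatrix_mulVec_le hk h (B := 2 * B)
    (x := (givensMatrix c s k k' * E) i) (fun l => ?_) j
  · linarith
  · exact norm_givensMatrix_mulVec_le hk hcs (x := fun i => E i l) (fun m => hE m l) i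

variable {c₀ s₀ : ℂ} {ε : ℝ}

theorem FlRot.norm_sub_le (hε : 0 ≤ ε) (hε1 : 34 * ε ≤ 1) (hk : k ≠ k')
    (hcs : ‖c₀‖ ^ 2 + ‖s₀‖ ^ 2 = 1) (hc : ‖c - c₀‖ ≤ 34 * ε) (hs : ‖s - s₀‖ ≤ 34 * ε)
    {x x' : Fin n → ℂ} (h : FlRot ε c s k k' x x') {B : ℝ} (hx : ∀ i, ‖x i‖ ≤ B) (i : Fin n) :
    ‖x' i - (givensMatrix c₀ s₀ k k' *ᵥ x) i‖ ≤ 220 * ε * B := by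
  have hB : 0 ≤ B := (norm_nonneg _).trans (hx k)
  have nc := norm_fst_le_one hcs
  have ns := norm_snd_le_one hcs
  have hε' : ε ≤ 1 := by linarith
  have key : (76 + 34) * ε * (‖x k‖ + ‖x k'‖) ≤ 220 * ε * B := by
    calc (76 + 34) * ε * (‖x k‖ + ‖x k'‖) ≤ (76 + 34) * ε * (B + B) := by
          gcongr <;> apply hx
      _ = _ := by ring
  obtain ⟨h1, h2, h3⟩ := h
  by_cases hi : i = k
  · subst hi
    rw [givensMatrix_mulVec_fst]
    refine (h1.norm_sub_le_of_approx hε hε1 hε' ?_ ?_ ?_ ?_).trans key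
    · rwa [norm_star]
    · rwa [norm_star]
    · rwa [← star_sub, norm_star]
    · rwa [← star_sub, norm_star]
  by_cases hi' : i = k'
  · subst hi'
    rw [givensMatrix_mulVec_snd hk]
    refine (h2.norm_sub_le_of_approx hε hε1 hε' ?_ nc ?_ hc).trans key
    · rwa [norm_neg]
    · rwa [neg_sub_neg, norm_sub_rev]
  · rw [givensMatrix_mulVec_of_ne hi hi', h3 i hi hi', sub_self, norm_zero]
    positivity

/-- Only two coordinates carry an error, hence the factor `2 · 220`, independent of `n`. -/
theorem FlRot.norm_toLp_sub_le (hε : 0 ≤ ε) (hε1 : 34 * ε ≤ 1) (hk : k ≠ k')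
    (hcs : ‖c₀‖ ^ 2 + ‖s₀‖ ^ 2 = 1) (hc : ‖c - c₀‖ ≤ 34 * ε) (hs : ‖s - s₀‖ ≤ 34 * ε)
    {x x' : Fin n → ℂ} (h : FlRot ε c s k k' x x') :
    ‖WithLp.toLp 2 (x' - givensMatrix c₀ s₀ k k' *ᵥ x)‖ ≤ 440 * ε * ‖WithLp.toLp 2 x‖ := by
  have hd := h.norm_sub_le hε hε1 hk hcs hc hs
    (fun i => PiLp.norm_apply_le (WithLp.toLp 2 x) i)
  have e : x' - givensMatrix c₀ s₀ k k' *ᵥ x =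
      Pi.single k (x' k - (givensMatrix c₀ s₀ k k' *ᵥ x) k) +
        Pi.single k' (x' k' - (givensMatrix c₀ s₀ k k' *ᵥ x) k') := by
    ext i
    by_cases hi : i = k
    · subst hi
      simp [hk]
    by_cases hi' : i = k'
    · subst hi'
      simp [hi]
    · simp [hi, hi', givensMatrix_mulVec_of_ne hi hi', h.2.2 i hi hi']
  rw [e, WithLp.toLp_add]
  refine (norm_add_le _ _).trans ?_
  rw [PiLp.toLp_single, PiLp.toLp_single, PiLp.norm_single, PiLp.norm_single]
  linarith [hd k, hd k']

/-- The half-transformed matrix has entries at most `3B`, so the second pass commits `3 · 220`; the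
error 220 of the first pass is at most doubled by it. -/
theorem FlSim.norm_sub_le (hε : 0 ≤ ε) (hε1 : 220 * ε ≤ 1) (hk : k ≠ k')
    (hcs : ‖c₀‖ ^ 2 + ‖s₀‖ ^ 2 = 1) (hc : ‖c - c₀‖ ≤ 34 * ε) (hs : ‖s - s₀‖ ≤ 34 * ε)
    {W W' : Matrix (Fin n) (Fin n) ℂ} (h : FlSim ε c s k k' W W') {B : ℝ}
    (hW : ∀ i j, ‖W i j‖ ≤ B) (i j : Fin n) :
    ‖W' i j - (givensMatrix c₀ s₀ k k' * W * (givensMatrix c₀ s₀ k k')ᴴ) i j‖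
      ≤ 1100 * ε * B := by
  obtain ⟨W₁, h1, h2⟩ := h
  have hB : 0 ≤ B := (norm_nonneg _).trans (hW i j)
  have hcs' : ‖star c₀‖ ^ 2 + ‖star s₀‖ ^ 2 = 1 := by rwa [norm_star, norm_star]
  have e1 : ∀ i j, ‖W₁ i j - (givensMatrix c₀ s₀ k k' * W) i j‖ ≤ 220 * ε * B := fun i j =>
    (h1 j).norm_sub_le hε (by linarith) hk hcs hc hs (fun i => hW i j) i
  have n1 : ∀ i j, ‖W₁ i j‖ ≤ 3 * B := fun i j => by
    have := norm_givensMatrix_mulVec_le hk hcs (x := fun i => W i j) (fun i => hW i j) i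
    have h3 : ‖W₁ i j‖ ≤ ‖W₁ i j - (givensMatrix c₀ s₀ k k' * W) i j‖ +
        ‖(givensMatrix c₀ s₀ k k' * W) i j‖ := norm_le_norm_sub_add _ _
    have h4 : ‖(givensMatrix c₀ s₀ k k' * W) i j‖ ≤ 2 * B := this
    nlinarith [e1 i j]
  have e2 := (h2 i).norm_sub_le hε (by linarith) hk hcs' (c := star c) (s := star s)
    (by rwa [← star_sub, norm_star]) (by rwa [← star_sub, norm_star]) (n1 i) j
  have e3 := norm_givensMatrix_mulVec_le hk hcs'
    (x := fun l => W₁ i l - (givensMatrix c₀ s₀ k k' * W) i l) (e1 i) j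
  rw [mul_givensMatrix_conjTranspose_apply hk]
  have e4 : (givensMatrix (star c₀) (star s₀) k k' *ᵥ
      fun l => W₁ i l - (givensMatrix c₀ s₀ k k' * W) i l) j =
      (givensMatrix (star c₀) (star s₀) k k' *ᵥ W₁ i) j -
        (givensMatrix (star c₀) (star s₀) k k' *ᵥ (givensMatrix c₀ s₀ k k' * W) i) j :=
    congrFun (Matrix.mulVec_sub _ (W₁ i) ((givensMatrix c₀ s₀ k k' * W) i)) j
  rw [e4] at e3
  have := norm_sub_le_norm_sub_add_norm_sub (W' i j)
    ((givensMatrix (star c₀) (star s₀) k k' *ᵥ W₁ i) j)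
    ((givensMatrix (star c₀) (star s₀) k k' *ᵥ (givensMatrix c₀ s₀ k k' * W) i) j)
  linarith

end Givens

/-! ### Matrix norms -/

section Norms

variable {n : ℕ}

theorem norm_toLp_mulVec_le (M : Matrix (Fin n) (Fin n) ℂ) (x : Fin n → ℂ) :
    ‖WithLp.toLp 2 (M *ᵥ x)‖ ≤ ‖M‖ * ‖WithLp.toLp 2 x‖ :=
  M.l2_opNorm_mulVec (WithLp.toLp 2 x)

theorem norm_toLp_unitary_mulVec_le {U : Matrix (Fin n) (Fin n) ℂ}
    (hU : U ∈ Matrix.unitaryGroup (Fin n) ℂ) (x : Fin n → ℂ) :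
    ‖WithLp.toLp 2 (U *ᵥ x)‖ ≤ ‖WithLp.toLp 2 x‖ := by
  have h : ‖U‖ ≤ 1 := by
    rw [← mul_one U, CStarRing.norm_mem_unitary_mul _ hU, ← Matrix.diagonal_one,
      Matrix.l2_opNorm_diagonal]
    exact (pi_norm_le_iff_of_nonneg zero_le_one).2 fun i => by simp
  exact (norm_toLp_mulVec_le U x).trans (mul_le_of_le_one_left (norm_nonneg _) h)

theorem norm_apply_le_l2_opNorm (M : Matrix (Fin n) (Fin n) ℂ) (i j : Fin n) : ‖M i j‖ ≤ ‖M‖ := by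
  have h := norm_toLp_mulVec_le M (Pi.single j (1 : ℂ))
  rw [PiLp.toLp_single, PiLp.norm_single, norm_one, mul_one] at h
  refine le_trans ?_ h
  have hi := PiLp.norm_apply_le (β := fun _ : Fin n => ℂ) (WithLp.toLp 2 (M *ᵥ Pi.single j 1)) i
  simpa using hi

/-- Cauchy–Schwarz in each row. Apart from the number of steps, this is the only way the dimension
enters the error. -/
theorem l2_opNorm_le_of_forall_norm_apply_le {M : Matrix (Fin n) (Fin n) ℂ} {δ : ℝ} (hδ : 0 ≤ δ)
    (h : ∀ i j, ‖M i j‖ ≤ δ) : ‖M‖ ≤ n * δ := by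
  rw [Matrix.cstar_norm_def]
  refine ContinuousLinearMap.opNorm_le_bound _ (by positivity) fun x => ?_
  refine (sq_le_sq₀ (norm_nonneg _) (by positivity)).mp ?_
  rw [EuclideanSpace.norm_sq_eq, mul_pow, EuclideanSpace.norm_sq_eq]
  have row : ∀ i, ‖(M *ᵥ x.ofLp) i‖ ^ 2 ≤ δ ^ 2 * (n * ∑ j, ‖x.ofLp j‖ ^ 2) := fun i => by
    have h1 : ‖(M *ᵥ x.ofLp) i‖ ≤ δ * ∑ j, ‖x.ofLp j‖ := by
      rw [Finset.mul_sum]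
      refine (norm_sum_le Finset.univ fun j => M i j * x.ofLp j).trans
        (Finset.sum_le_sum fun j _ => ?_)
      rw [norm_mul]
      exact mul_le_mul_of_nonneg_right (h i j) (norm_nonneg _)
    have h2 := sq_sum_le_card_mul_sum_sq (s := Finset.univ) (f := fun j => ‖x.ofLp j‖)
    rw [Finset.card_univ, Fintype.card_fin] at h2
    calc ‖(M *ᵥ x.ofLp) i‖ ^ 2 ≤ (δ * ∑ j, ‖x.ofLp j‖) ^ 2 := by gcongr
      _ = δ ^ 2 * (∑ j, ‖x.ofLp j‖) ^ 2 := mul_pow _ _ _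
      _ ≤ _ := by gcongr
  calc ∑ i, ‖(M *ᵥ x.ofLp) i‖ ^ 2 ≤ ∑ _i : Fin n, δ ^ 2 * (n * ∑ j, ‖x.ofLp j‖ ^ 2) :=
        Finset.sum_le_sum fun i _ => row i
    _ = _ := by
      rw [Finset.sum_const, Finset.card_univ, Fintype.card_fin, nsmul_eq_mul]
      ring

theorem norm_unitary_conj {U : Matrix (Fin n) (Fin n) ℂ} (hU : U ∈ Matrix.unitaryGroup (Fin n) ℂ)
    (M : Matrix (Fin n) (Fin n) ℂ) : ‖U * M * Uᴴ‖ = ‖M‖ := by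
  rw [← Matrix.star_eq_conjTranspose, CStarRing.norm_mul_mem_unitary _ (Unitary.star_mem hU),
    CStarRing.norm_mem_unitary_mul _ hU]

end Norms

/-! ### The deviation from Hermitian plus rank one -/

section Skew

variable {n : ℕ}

/-- Twice the skew-Hermitian part of `A - u v*`. -/
def skewDefect (A : Matrix (Fin n) (Fin n) ℂ) (u v : Fin n → ℂ) : Matrix (Fin n) (Fin n) ℂ :=
  (A - Matrix.vecMulVec u (star v)) - (A - Matrix.vecMulVec u (star v))ᴴ

theorem skewDefect_apply (A : Matrix (Fin n) (Fin n) ℂ) (u v : Fin n → ℂ) (i j : Fin n) :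
    skewDefect A u v i j =
      A i j - u i * star (v j) - (star (A j i) - star (u j) * v i) := by
  simp only [skewDefect, Matrix.sub_apply, Matrix.conjTranspose_apply, Matrix.vecMulVec_apply,
    Pi.star_apply, star_sub, star_mul', star_star]

/-- The rank-one term is transformed like the matrix. For unitary `U` the size of the defect is
therefore unchanged: only rounding can increase it. -/
theorem skewDefect_unitary_conj (U A : Matrix (Fin n) (Fin n) ℂ) (u v : Fin n → ℂ) :
    skewDefect (U * A * Uᴴ) (U *ᵥ u) (U *ᵥ v) = U * skewDefect A u v * Uᴴ := by
  have h : Matrix.vecMulVec (U *ᵥ u) (star (U *ᵥ v)) =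
      U * Matrix.vecMulVec u (star v) * Uᴴ := by
    rw [Matrix.mul_vecMulVec, Matrix.vecMulVec_mul, Matrix.star_mulVec]
  rw [skewDefect, h, skewDefect]
  simp only [Matrix.mul_sub, Matrix.sub_mul, Matrix.conjTranspose_sub, Matrix.conjTranspose_mul,
    Matrix.conjTranspose_conjTranspose, Matrix.mul_assoc]

/-- If the stored lower part of `R` and the rank-one term of `R` are close to those of a unitary
similarity of `A`, then so is the whole matrix determined by `R`. -/
theorem Generators.norm_toMatrix_sub_le [Nonempty (Fin n)] {A U : Matrix (Fin n) (Fin n) ℂ} {u v : Fin n → ℂ}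
    {R : Generators n} {δ τ κ : ℝ} (hU : U ∈ Matrix.unitaryGroup (Fin n) ℂ)
    (hκ : ‖skewDefect A u v‖ ≤ κ)
    (hlow : ∀ i j, j ≤ i → ‖R.low i j - (U * A * Uᴴ) i j‖ ≤ δ)
    (huv : ∀ i j, ‖R.u i * star (R.v j) - (U *ᵥ u) i * star ((U *ᵥ v) j)‖ ≤ τ) :
    (∀ i j, ‖R.toMatrix i j - (U * A * Uᴴ) i j‖ ≤ δ + 2 * τ + κ) ∧
      ‖skewDefect R.toMatrix R.u R.v‖ ≤ κ + 2 * δ + 2 * τ := by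
  have hκ0 : 0 ≤ κ := (norm_nonneg _).trans hκ
  set X := U * A * Uᴴ with hX
  set y := U *ᵥ u with hy
  set z := U *ᵥ v with hz
  have hK : ∀ i j, ‖skewDefect X y z i j‖ ≤ κ := fun i j => by
    refine (norm_apply_le_l2_opNorm _ i j).trans ?_
    rwa [hX, hy, hz, skewDefect_unitary_conj, norm_unitary_conj hU]
  have hvu : ∀ i j, ‖star (R.u j) * R.v i - star (y j) * z i‖ ≤ τ := fun i j => by
    have := huv j i
    rwa [← norm_star, star_sub, star_mul', star_mul', star_star, star_star] at this
  constructor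
  · intro i j
    by_cases hji : j ≤ i
    · have hτ := (norm_nonneg _).trans (huv i j)
      rw [Generators.toMatrix, if_pos hji]
      linarith [hlow i j hji]
    · have hl := hlow j i (not_le.1 hji).le
      rw [Generators.toMatrix, if_neg hji]
      -- The entries of `X` satisfy the reconstruction formula up to the corresponding entry of the
      -- defect of `X`, which therefore joins the rounding errors.
      have e : star (R.low j i) - star (R.u j) * R.v i + R.u i * star (R.v j) - X i j =
          star (R.low j i - X j i) - (star (R.u j) * R.v i - star (y j) * z i) +
            (R.u i * star (R.v j) - y i * star (z j)) - skewDefect X y z i j := by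
        rw [skewDefect_apply, star_sub]
        ring
      rw [e]
      refine (norm_sub_le _ _).trans ?_
      grw [norm_add_le, norm_sub_le, norm_star, hl, hvu i j, huv i j, hK i j]
      linarith
  · have hd : skewDefect R.toMatrix R.u R.v =
        Matrix.diagonal fun i => skewDefect R.toMatrix R.u R.v i i := by
      ext i j
      by_cases hij : i = j
      · subst hij
        simp
      · rw [Matrix.diagonal_apply_ne _ hij, skewDefect_apply]
        rcases lt_or_gt_of_ne hij with h | h
        · simp only [Generators.toMatrix, if_pos h.le, if_neg (not_le.2 h)]
          ring
        · simp only [Generators.toMatrix, if_pos h.le, if_neg (not_le.2 h), star_add, star_sub,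
            star_mul', star_star]
          ring
    have hdiag : ∀ i, ‖skewDefect R.toMatrix R.u R.v i i‖ ≤ κ + 2 * δ + 2 * τ := fun i => by
      have hl := hlow i i le_rfl
      have e : skewDefect R.toMatrix R.u R.v i i =
          skewDefect X y z i i + (R.low i i - X i i) - star (R.low i i - X i i) -
            (R.u i * star (R.v i) - y i * star (z i)) +
              (star (R.u i) * R.v i - star (y i) * z i) := by
        rw [skewDefect_apply, skewDefect_apply, Generators.toMatrix, if_pos le_rfl, star_sub]
        ring
      rw [e]
      refine (norm_add_le _ _).trans ?_
      grw [norm_sub_le, norm_sub_le, norm_add_le, norm_star, hl, hvu i i, huv i i, hK i i]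
      linarith
    rw [hd, Matrix.l2_opNorm_diagonal]
    obtain ⟨i⟩ := ‹Nonempty (Fin n)›
    exact (pi_norm_le_iff_of_nonneg ((norm_nonneg _).trans (hdiag i))).2 hdiag

end Skew

/-! ### Error of one elementary step -/

section Step

variable {n : ℕ} {ε B : ℝ}

theorem FlMatrix.norm_sub_le (hε : 0 ≤ ε) (hε1 : ε ≤ 1) {R : Generators n}
    {W : Matrix (Fin n) (Fin n) ℂ} (h : FlMatrix ε R W) (hM : ‖R.toMatrix‖ ≤ B)
    (huv : ‖WithLp.toLp 2 R.u‖ * ‖WithLp.toLp 2 R.v‖ ≤ B) (i j : Fin n) :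
    ‖W i j - R.toMatrix i j‖ ≤ 170 * ε * B := by
  have hB : 0 ≤ B := (norm_nonneg _).trans hM
  have uv : ∀ i j, ‖R.u i‖ * ‖R.v j‖ ≤ B := fun i j =>
    (mul_le_mul (PiLp.norm_apply_le (WithLp.toLp 2 R.u) i)
      (PiLp.norm_apply_le (WithLp.toLp 2 R.v) j) (norm_nonneg _) (norm_nonneg _)).trans huv
  by_cases hji : j ≤ i
  · rw [Generators.toMatrix, if_pos hji, h.1 i j hji, sub_self, norm_zero]
    positivity
  · obtain ⟨a, b, t, ha, ht, hb, hW⟩ := h.2 i j (not_le.1 hji)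
    have hl : ‖star (R.low j i)‖ ≤ B := by
      have := (norm_apply_le_l2_opNorm R.toMatrix j i).trans hM
      rwa [Generators.toMatrix, if_pos (not_le.1 hji).le, ← norm_star] at this
    have n1 : ‖star (R.u j) * R.v i‖ ≤ B := by
      rw [norm_mul, norm_star]
      exact uv j i
    have n2 : ‖R.u i * star (R.v j)‖ ≤ B := by
      rw [norm_mul, norm_star]
      exact uv i j
    have ea : ‖a - star (R.u j) * R.v i‖ ≤ 12 * ε * B := by
      refine (ha.norm_sub_le hε hε1).trans ?_
      rw [← norm_mul]
      gcongr
    have eb : ‖b - R.u i * star (R.v j)‖ ≤ 12 * ε * B := by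
      refine (hb.norm_sub_le hε hε1).trans ?_
      rw [← norm_mul]
      gcongr
    have et := ht.norm_sub_le_of_approx hε hε1 (x := star (R.low j i))
      (y := -(star (R.u j) * R.v i)) (B := 2 * B) (δ := 12 * ε * B)
      (by rw [norm_neg]; linarith) (by rwa [sub_self, norm_zero, zero_add, neg_sub_neg,
        norm_sub_rev])
    have nt : ‖star (R.low j i) + -(star (R.u j) * R.v i)‖ ≤ 2 * B :=
      (norm_add_le _ _).trans (by rw [norm_neg]; linarith)
    -- Here `et` contributes `2 · 2 + 3 · 12 = 40` and `eb` another 12. The last addition raises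
    -- this to `2 · 3 + 3 · 52 = 162`.
    have eW := hW.norm_sub_le_of_approx hε hε1 (B := 3 * B) (δ := 52 * ε * B)
      (x := star (R.low j i) + -(star (R.u j) * R.v i)) (y := R.u i * star (R.v j))
      (by linarith) (by linarith)
    rw [Generators.toMatrix, if_neg hji, sub_eq_add_neg (star (R.low j i))]
    have : 0 ≤ ε * B := by positivity
    linarith

theorem FlSim.norm_sub_le_of_approx {c s c₀ s₀ : ℂ} {k k' : Fin n} {γ : ℝ} (hε : 0 ≤ ε)
    (hε1 : 220 * ε ≤ 1) (hγ : γ * ε ≤ 1) (hk : k ≠ k')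
    (hcs : ‖c₀‖ ^ 2 + ‖s₀‖ ^ 2 = 1) (hc : ‖c - c₀‖ ≤ 34 * ε) (hs : ‖s - s₀‖ ≤ 34 * ε)
    {M W W' : Matrix (Fin n) (Fin n) ℂ} (h : FlSim ε c s k k' W W')
    (hM : ∀ i j, ‖M i j‖ ≤ B) (hW : ∀ i j, ‖W i j - M i j‖ ≤ γ * ε * B) (i j : Fin n) :
    ‖W' i j - (givensMatrix c₀ s₀ k k' * M * (givensMatrix c₀ s₀ k k')ᴴ) i j‖
      ≤ (2200 + 4 * γ) * ε * B := by
  have hB : 0 ≤ B := (norm_nonneg _).trans (hM i j)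
  have nW : ∀ i j, ‖W i j‖ ≤ 2 * B := fun i j => by
    have := norm_le_norm_sub_add (W i j) (M i j)
    nlinarith [hM i j, hW i j]
  have e1 := h.norm_sub_le hε hε1 hk hcs hc hs nW i j
  have e2 := norm_givensMatrix_conj_le hk hcs (E := W - M) hW i j
  rw [Matrix.mul_sub, Matrix.sub_mul, Matrix.sub_apply] at e2
  refine (norm_sub_le_norm_sub_add_norm_sub _ _ _).trans ((add_le_add e1 e2).trans ?_)
  linarith

/-- The generators `R` agree, up to rounding errors of size `ε` relative to `B`, with the data
`U A U*`, `U u`, `U v`. -/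
structure NearSim (ε B : ℝ) (A : Matrix (Fin n) (Fin n) ℂ) (u v : Fin n → ℂ) (R : Generators n)
    (U : Matrix (Fin n) (Fin n) ℂ) : Prop where
  mem : U ∈ Matrix.unitaryGroup (Fin n) ℂ
  low : ∀ i j, j ≤ i → ‖R.low i j - (U * A * Uᴴ) i j‖ ≤ 14000 * ε * B
  u : ‖WithLp.toLp 2 (R.u - U *ᵥ u)‖ ≤ 1320 * ε * ‖WithLp.toLp 2 u‖
  v : ‖WithLp.toLp 2 (R.v - U *ᵥ v)‖ ≤ 1320 * ε * ‖WithLp.toLp 2 v‖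

/-- A column outside the plane of rotation is affected from the left only. This applies to the
column in which a chase overwrites entries by the computed norm and by 0. -/
theorem givensMatrix_conj_apply_of_ne {c s : ℂ} {k k' m : Fin n} (hk : k ≠ k') (hm : m ≠ k)
    (hm' : m ≠ k') (M : Matrix (Fin n) (Fin n) ℂ) (i : Fin n) :
    (givensMatrix c s k k' * M * (givensMatrix c s k k')ᴴ) i m =
      (givensMatrix c s k k' *ᵥ fun l => M l m) i := by
  rw [mul_givensMatrix_conjTranspose_apply hk, givensMatrix_mulVec_of_ne hm hm']
  rfl

theorem FlRot.norm_toLp_sub_le_of_comp {c₁ s₁ c₂ s₂ a₁ b₁ a₂ b₂ : ℂ} {k k' k'' : Fin n}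
    (hε : 0 ≤ ε) (hε1 : 440 * ε ≤ 1) (hk : k ≠ k') (hk' : k' ≠ k'')
    (hcs₁ : ‖a₁‖ ^ 2 + ‖b₁‖ ^ 2 = 1) (hc₁ : ‖c₁ - a₁‖ ≤ 34 * ε) (hs₁ : ‖s₁ - b₁‖ ≤ 34 * ε)
    (hcs₂ : ‖a₂‖ ^ 2 + ‖b₂‖ ^ 2 = 1) (hc₂ : ‖c₂ - a₂‖ ≤ 34 * ε) (hs₂ : ‖s₂ - b₂‖ ≤ 34 * ε)
    {x y z : Fin n → ℂ} (h₂ : FlRot ε c₂ s₂ k' k'' x y) (h₁ : FlRot ε c₁ s₁ k k' y z) :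
    ‖WithLp.toLp 2 (z - (givensMatrix a₁ b₁ k k' * givensMatrix a₂ b₂ k' k'') *ᵥ x)‖
      ≤ 1320 * ε * ‖WithLp.toLp 2 x‖ := by
  set G₁ := givensMatrix a₁ b₁ k k' with hG₁
  set G₂ := givensMatrix a₂ b₂ k' k'' with hG₂
  have u₁ : G₁ ∈ Matrix.unitaryGroup (Fin n) ℂ := givensMatrix_mem_unitaryGroup hk hcs₁
  have u₂ : G₂ ∈ Matrix.unitaryGroup (Fin n) ℂ := givensMatrix_mem_unitaryGroup hk' hcs₂
  have e₂ := h₂.norm_toLp_sub_le hε (by linarith) hk' hcs₂ hc₂ hs₂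
  have e₁ := h₁.norm_toLp_sub_le hε (by linarith) hk hcs₁ hc₁ hs₁
  rw [← hG₂] at e₂
  rw [← hG₁] at e₁
  have ny : ‖WithLp.toLp 2 y‖ ≤ 2 * ‖WithLp.toLp 2 x‖ := by
    have : y = (y - G₂ *ᵥ x) + G₂ *ᵥ x := by abel
    rw [this, WithLp.toLp_add]
    refine (norm_add_le _ _).trans ?_
    nlinarith [norm_toLp_unitary_mulVec_le u₂ x, norm_nonneg (WithLp.toLp 2 x)]
  have e₃ := (norm_toLp_unitary_mulVec_le u₁ (y - G₂ *ᵥ x)).trans e₂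
  have e : z - (G₁ * G₂) *ᵥ x = (z - G₁ *ᵥ y) + G₁ *ᵥ (y - G₂ *ᵥ x) := by
    rw [Matrix.mulVec_sub, Matrix.mulVec_mulVec]
    abel
  rw [e, WithLp.toLp_add]
  refine (norm_add_le _ _).trans ((add_le_add e₁ e₃).trans ?_)
  nlinarith [mul_le_mul_of_nonneg_left ny hε]

theorem FlRot.norm_toLp_sub_le_loose {c s c₀ s₀ : ℂ} {k k' : Fin n} (hε : 0 ≤ ε)
    (hε1 : 34 * ε ≤ 1) (hk : k ≠ k') (hcs : ‖c₀‖ ^ 2 + ‖s₀‖ ^ 2 = 1) (hc : ‖c - c₀‖ ≤ 34 * ε)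
    (hs : ‖s - s₀‖ ≤ 34 * ε) {x x' : Fin n → ℂ} (h : FlRot ε c s k k' x x') :
    ‖WithLp.toLp 2 (x' - givensMatrix c₀ s₀ k k' *ᵥ x)‖ ≤ 1320 * ε * ‖WithLp.toLp 2 x‖ := by
  refine (h.norm_toLp_sub_le hε hε1 hk hcs hc hs).trans ?_
  gcongr
  norm_num

/-- `U` is the product of the exact rotations near the computed ones, or 1 for a deflation. One
similarity has entrywise error `2200 + 4 · 170 = 2880`, a second one `2200 + 4 · 2880 = 13720`,
which explains 14000. Overwritten entries are compared with the exact rotation of the stored column.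
-/
theorem QRStep.exists_nearSim {R R' : Generators n} (hε : 0 ≤ ε) (hε1 : 14000 * ε ≤ 1)
    (hM : ‖R.toMatrix‖ ≤ B) (huv : ‖WithLp.toLp 2 R.u‖ * ‖WithLp.toLp 2 R.v‖ ≤ B)
    (h : QRStep ε R R') : ∃ U, NearSim ε B R.toMatrix R.u R.v R' U := by
  have hB : 0 ≤ B := (norm_nonneg _).trans hM
  have hεB : 0 ≤ ε * B := by positivity
  have hMe : ∀ i j, ‖R.toMatrix i j‖ ≤ B := fun i j => (norm_apply_le_l2_opNorm _ i j).trans hM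
  have toM : ∀ {i j}, j ≤ i → R.toMatrix i j = R.low i j := fun {i j} hji => by
    rw [Generators.toMatrix, if_pos hji]
  have hlowB : ∀ {i j}, j ≤ i → ‖R.low i j‖ ≤ B := fun {i j} hji => by
    rw [← toM hji]
    exact hMe i j
  cases h with
  | startSingle k k' hk x y c s r W W' hG hW hW' hlow hu hv =>
    have hkk : k ≠ k' := fun e => by simp [e] at hk
    obtain ⟨c₀, s₀, hcs, hc, hs, -, -⟩ := hG.exists_exact hε (by linarith)
    refine ⟨givensMatrix c₀ s₀ k k', givensMatrix_mem_unitaryGroup hkk hcs, fun i j hji => ?_,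
      hu.norm_toLp_sub_le_loose hε (by linarith) hkk hcs hc hs,
      hv.norm_toLp_sub_le_loose hε (by linarith) hkk hcs hc hs⟩
    rw [hlow i j hji]
    have := hW'.norm_sub_le_of_approx hε (by linarith) (by linarith) hkk hcs hc hs hMe
      (hW.norm_sub_le hε (by linarith) hM huv) i j
    linarith
  | chaseSingle k k' m hk hm c s r W W' hG hW hW' hlow hu hv =>
    have hkk : k < k' := Fin.lt_def.2 (by omega)
    have hmk' := hm.trans hkk
    obtain ⟨c₀, s₀, hcs, hc, hs, hr, hz⟩ := hG.exists_exact hε (by linarith)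
    refine ⟨givensMatrix c₀ s₀ k k', givensMatrix_mem_unitaryGroup hkk.ne hcs, fun i j hji => ?_,
      hu.norm_toLp_sub_le_loose hε (by linarith) hkk.ne hcs hc hs,
      hv.norm_toLp_sub_le_loose hε (by linarith) hkk.ne hcs hc hs⟩
    rw [hlow i j hji]
    split_ifs with h1 h2
    · obtain ⟨rfl, rfl⟩ := h1
      rw [givensMatrix_conj_apply_of_ne hkk.ne hm.ne hmk'.ne, givensMatrix_mulVec_fst,
        toM hm.le, toM hmk'.le, norm_sub_rev]
      nlinarith [hlowB hm.le, hlowB hmk'.le]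
    · obtain ⟨rfl, rfl⟩ := h2
      rw [givensMatrix_conj_apply_of_ne hkk.ne hm.ne hmk'.ne, givensMatrix_mulVec_snd hkk.ne,
        toM hm.le, toM hmk'.le, hz, sub_self, norm_zero]
      positivity
    · have := hW'.norm_sub_le_of_approx hε (by linarith) (by linarith) hkk.ne hcs hc hs hMe
        (hW.norm_sub_le hε (by linarith) hM huv) i j
      linarith
  | startDouble k k' k'' hk hk' x y z c₁ s₁ c₂ s₂ r₁ r₂ W W₁ W' u₁ v₁ hG₂ hG₁ hW hW₁ hW' hlow
      hu₁ hu hv₁ hv =>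
    have hkk : k ≠ k' := fun e => by simp [e] at hk
    have hkk' : k' ≠ k'' := fun e => by rw [e] at hk; omega
    obtain ⟨a₂, b₂, hcs₂, hc₂, hs₂, -, -⟩ := hG₂.exists_exact hε (by linarith)
    obtain ⟨a₁, b₁, hcs₁, hc₁, hs₁, -, -⟩ := hG₁.exists_exact hε (by linarith)
    have m₂ := givensMatrix_mem_unitaryGroup hkk' hcs₂
    refine ⟨givensMatrix a₁ b₁ k k' * givensMatrix a₂ b₂ k' k'',
      mul_mem (givensMatrix_mem_unitaryGroup hkk hcs₁) m₂,
      fun i j hji => ?_,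
      hu₁.norm_toLp_sub_le_of_comp hε (by linarith) hkk hkk' hcs₁ hc₁ hs₁ hcs₂ hc₂ hs₂ hu,
      hv₁.norm_toLp_sub_le_of_comp hε (by linarith) hkk hkk' hcs₁ hc₁ hs₁ hcs₂ hc₂ hs₂ hv⟩
    have e₂ := hW₁.norm_sub_le_of_approx hε (by linarith) (by linarith) hkk' hcs₂ hc₂ hs₂ hMe
      (hW.norm_sub_le hε (by linarith) hM huv)
    have e₁ := hW'.norm_sub_le_of_approx hε (by linarith) (by linarith) hkk hcs₁ hc₁ hs₁
      (fun i j => (norm_apply_le_l2_opNorm _ i j).trans ((norm_unitary_conj m₂ _).trans_le hM))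
      e₂ i j
    rw [hlow i j hji, Matrix.conjTranspose_mul, ← Matrix.mul_assoc, Matrix.mul_assoc _ _ R.toMatrix,
      Matrix.mul_assoc (givensMatrix a₁ b₁ k k')]
    linarith
  | chaseDouble k k' k'' m hk hk' hm c₁ s₁ c₂ s₂ r₁ r₂ W W₁ W' u₁ v₁ hG₂ hG₁ hW hW₁ hW' hlow
      hu₁ hu hv₁ hv =>
    have hkk : k < k' := Fin.lt_def.2 (by omega)
    have hkk' : k' < k'' := Fin.lt_def.2 (by omega)
    have hmk' := hm.trans hkk
    have hmk'' := hmk'.trans hkk'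
    obtain ⟨a₂, b₂, hcs₂, hc₂, hs₂, hr₂, hz₂⟩ := hG₂.exists_exact hε (by linarith)
    obtain ⟨a₁, b₁, hcs₁, hc₁, hs₁, hr₁, hz₁⟩ := hG₁.exists_exact hε (by linarith)
    have m₂ := givensMatrix_mem_unitaryGroup hkk'.ne hcs₂
    have nM₂ : ∀ i j, ‖(givensMatrix a₂ b₂ k' k'' * R.toMatrix *
        (givensMatrix a₂ b₂ k' k'')ᴴ) i j‖ ≤ B := fun i j =>
      (norm_apply_le_l2_opNorm _ i j).trans ((norm_unitary_conj m₂ _).trans_le hM)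
    refine ⟨givensMatrix a₁ b₁ k k' * givensMatrix a₂ b₂ k' k'',
      mul_mem (givensMatrix_mem_unitaryGroup hkk.ne hcs₁) m₂,
      fun i j hji => ?_,
      hu₁.norm_toLp_sub_le_of_comp hε (by linarith) hkk.ne hkk'.ne hcs₁ hc₁ hs₁ hcs₂ hc₂ hs₂ hu,
      hv₁.norm_toLp_sub_le_of_comp hε (by linarith) hkk.ne hkk'.ne hcs₁ hc₁ hs₁ hcs₂ hc₂ hs₂ hv⟩
    have e₂ := hW₁.norm_sub_le_of_approx hε (by linarith) (by linarith) hkk'.ne hcs₂ hc₂ hs₂ hMe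
      (hW.norm_sub_le hε (by linarith) hM huv)
    have e₁ := hW'.norm_sub_le_of_approx hε (by linarith) (by linarith) hkk.ne hcs₁ hc₁ hs₁
      nM₂ e₂ i j
    rw [hlow i j hji, Matrix.conjTranspose_mul, ← Matrix.mul_assoc, Matrix.mul_assoc _ _ R.toMatrix,
      Matrix.mul_assoc (givensMatrix a₁ b₁ k k')]
    set M₂ := givensMatrix a₂ b₂ k' k'' * R.toMatrix * (givensMatrix a₂ b₂ k' k'')ᴴ with hM₂
    have w₀ : M₂ k m = R.low k m := by
      rw [hM₂, givensMatrix_conj_apply_of_ne hkk'.ne hmk'.ne hmk''.ne,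
        givensMatrix_mulVec_of_ne hkk.ne (hkk.trans hkk').ne, toM hm.le]
    -- The rotation `hG₁` is computed from `r₂` instead of the exact entry `M₂ k' m`. The
    -- discrepancy, at most `15ε · 2B`, reaches the final entries through coefficients of modulus at
    -- most 1.
    have w₁ : ‖M₂ k' m - r₂‖ ≤ 30 * ε * B := by
      rw [hM₂, givensMatrix_conj_apply_of_ne hkk'.ne hmk'.ne hmk''.ne,
        givensMatrix_mulVec_fst, toM hmk'.le, toM hmk''.le]
      nlinarith [hlowB hmk'.le, hlowB hmk''.le]
    have w₂ : M₂ k'' m = 0 := by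
      rw [hM₂, givensMatrix_conj_apply_of_ne hkk'.ne hmk'.ne hmk''.ne,
        givensMatrix_mulVec_snd hkk'.ne, toM hmk'.le, toM hmk''.le, hz₂]
    split_ifs with h1 h2
    · obtain ⟨rfl, rfl⟩ := h1
      rw [givensMatrix_conj_apply_of_ne hkk.ne hm.ne hmk'.ne, givensMatrix_mulVec_fst, w₀]
      have hr₂B : ‖(r₂ : ℂ)‖ ≤ 2 * B := by
        have := norm_le_norm_sub_add (r₂ : ℂ) (M₂ k' j)
        rw [norm_sub_rev] at this
        nlinarith [nM₂ k' j]
      have hb : ‖star b₁ * (M₂ k' j - r₂)‖ ≤ 30 * ε * B := by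
        rw [norm_mul, norm_star]
        exact (mul_le_of_le_one_left (norm_nonneg _) (norm_snd_le_one hcs₁)).trans w₁
      rw [norm_sub_rev, show star a₁ * R.low i j + star b₁ * M₂ k' j - (r₁ : ℂ) =
        (star a₁ * R.low i j + star b₁ * r₂ - r₁) + star b₁ * (M₂ k' j - r₂) by ring]
      refine (norm_add_le _ _).trans ((add_le_add hr₁ hb).trans ?_)
      nlinarith [hlowB hm.le]
    · obtain ⟨rfl, rfl | rfl⟩ := h2
      · rw [givensMatrix_conj_apply_of_ne hkk.ne hm.ne hmk'.ne, givensMatrix_mulVec_snd hkk.ne, w₀]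
        have ha : ‖a₁ * (M₂ i j - r₂)‖ ≤ 30 * ε * B := by
          rw [norm_mul]
          exact (mul_le_of_le_one_left (norm_nonneg _) (norm_fst_le_one hcs₁)).trans w₁
        rw [zero_sub, norm_neg, show -b₁ * R.low k j + a₁ * M₂ i j =
          (-b₁ * R.low k j + a₁ * r₂) + a₁ * (M₂ i j - r₂) by ring, hz₁, zero_add]
        linarith
      · rw [givensMatrix_conj_apply_of_ne hkk.ne hm.ne hmk'.ne,
          givensMatrix_mulVec_of_ne (hkk.trans hkk').ne' hkk'.ne', w₂, sub_self, norm_zero]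
        positivity
    · linarith
  | deflate k m hm hsmall hlow hu hv =>
    refine ⟨1, one_mem _, fun i j hji => ?_, ?_, ?_⟩
    · rw [hlow i j hji, Matrix.conjTranspose_one, one_mul, mul_one, toM hji]
      split_ifs with h1
      · obtain ⟨rfl, rfl⟩ := h1
        rw [zero_sub, norm_neg]
        nlinarith
      · rw [sub_self, norm_zero]
        positivity
    · rw [hu, Matrix.one_mulVec, sub_self, WithLp.toLp_zero, norm_zero]
      positivity
    · rw [hv, Matrix.one_mulVec, sub_self, WithLp.toLp_zero, norm_zero]
      positivity

theorem norm_toLp_le_of_forall_norm_apply_le {x y : Fin n → ℂ} {t : ℝ} (ht : 0 ≤ t)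
    (h : ∀ i, ‖x i‖ ≤ t * ‖y i‖) : ‖WithLp.toLp 2 x‖ ≤ t * ‖WithLp.toLp 2 y‖ := by
  refine (sq_le_sq₀ (norm_nonneg _) (by positivity)).mp ?_
  rw [mul_pow, EuclideanSpace.norm_sq_eq, EuclideanSpace.norm_sq_eq, Finset.mul_sum]
  refine Finset.sum_le_sum fun i _ => ?_
  rw [← mul_pow]
  exact pow_le_pow_left₀ (norm_nonneg _) (h i) 2

theorem Stores.nearSim {A : Matrix (Fin n) (Fin n) ℂ} {u v : Fin n → ℂ} {R : Generators n}
    (hε : 0 ≤ ε) (hA : ‖A‖ ≤ B) (h : Stores ε A u v R) : NearSim ε B A u v R 1 := by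
  have hB : 0 ≤ B := (norm_nonneg _).trans hA
  have hεB : 0 ≤ ε * B := by positivity
  obtain ⟨hl, hu, hv⟩ := h
  have vec : ∀ {x y : Fin n → ℂ}, (∀ i, FlC ε (x i) (y i)) →
      ‖WithLp.toLp 2 (y - (1 : Matrix (Fin n) (Fin n) ℂ) *ᵥ x)‖ ≤
        1320 * ε * ‖WithLp.toLp 2 x‖ := fun {x y} hxy => by
    rw [Matrix.one_mulVec]
    refine (norm_toLp_le_of_forall_norm_apply_le (t := 2 * ε) (by positivity)
      fun i => (hxy i).norm_sub_le hε).trans ?_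
    gcongr
    norm_num
  refine ⟨one_mem _, fun i j hji => ?_, vec hu, vec hv⟩
  rw [Matrix.conjTranspose_one, one_mul, mul_one]
  refine ((hl i j hji).norm_sub_le hε).trans ?_
  nlinarith [(norm_apply_le_l2_opNorm A i j).trans hA]

end Step

/-! ### Error of the whole iteration -/

section Run

variable {n : ℕ} {ε S : ℝ}

theorem norm_mul_star_sub_le {x y x₀ y₀ : ℂ} {a b γ : ℝ} (hγ : 0 ≤ γ) (hγ1 : γ ≤ 1)
    (hx₀ : ‖x₀‖ ≤ a) (hy₀ : ‖y₀‖ ≤ b) (hx : ‖x - x₀‖ ≤ γ * a) (hy : ‖y - y₀‖ ≤ γ * b) :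
    ‖x * star y - x₀ * star y₀‖ ≤ 3 * γ * (a * b) := by
  have ha : 0 ≤ a := (norm_nonneg _).trans hx₀
  have hb : 0 ≤ b := (norm_nonneg _).trans hy₀
  have ny : ‖y‖ ≤ 2 * b := by
    have := norm_le_norm_sub_add y y₀
    nlinarith
  rw [show x * star y - x₀ * star y₀ = (x - x₀) * star y + x₀ * star (y - y₀) by
    rw [star_sub]; ring]
  refine (norm_add_le _ _).trans ?_
  rw [norm_mul, norm_mul, norm_star, norm_star]
  calc ‖x - x₀‖ * ‖y‖ + ‖x₀‖ * ‖y - y₀‖ ≤ (γ * a) * (2 * b) + a * (γ * b) := by gcongr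
    _ = _ := by ring

/-- The effect of one approximate unitary similarity on the matrix determined by the generators,
on its deviation from Hermitian plus rank one, and on the norms of the two vectors. -/
theorem NearSim.bounds [Nonempty (Fin n)] {B κ : ℝ} {A U : Matrix (Fin n) (Fin n) ℂ}
    {u v : Fin n → ℂ} {R : Generators n} (hε : 0 ≤ ε) (hε1 : 1320 * ε ≤ 1)
    (huv : ‖WithLp.toLp 2 u‖ * ‖WithLp.toLp 2 v‖ ≤ B) (hκ : ‖skewDefect A u v‖ ≤ κ)
    (h : NearSim ε B A u v R U) :
    ‖R.toMatrix - U * A * Uᴴ‖ ≤ n * (36000 * ε * B + κ) ∧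
      ‖skewDefect R.toMatrix R.u R.v‖ ≤ 36000 * ε * B + κ ∧
      ‖WithLp.toLp 2 R.u‖ ≤ (1 + 1320 * ε) * ‖WithLp.toLp 2 u‖ ∧
      ‖WithLp.toLp 2 R.v‖ ≤ (1 + 1320 * ε) * ‖WithLp.toLp 2 v‖ := by
  have hB : 0 ≤ B := (mul_nonneg (norm_nonneg _) (norm_nonneg _)).trans huv
  have hκ0 : 0 ≤ κ := (norm_nonneg _).trans hκ
  have hεB : 0 ≤ ε * B := by positivity
  have vec : ∀ {x y : Fin n → ℂ}, ‖WithLp.toLp 2 (y - U *ᵥ x)‖ ≤ 1320 * ε * ‖WithLp.toLp 2 x‖ →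
      ‖WithLp.toLp 2 y‖ ≤ (1 + 1320 * ε) * ‖WithLp.toLp 2 x‖ := fun {x y} hxy => by
    have e : y = (y - U *ᵥ x) + U *ᵥ x := by abel
    rw [e, WithLp.toLp_add]
    refine (norm_add_le _ _).trans ?_
    linarith [norm_toLp_unitary_mulVec_le h.mem x]
  have entry : ∀ (x : Fin n → ℂ) i, ‖(U *ᵥ x) i‖ ≤ ‖WithLp.toLp 2 x‖ := fun x i =>
    (PiLp.norm_apply_le (WithLp.toLp 2 (U *ᵥ x)) i).trans (norm_toLp_unitary_mulVec_le h.mem x)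
  have hτ : ∀ i j, ‖R.u i * star (R.v j) - (U *ᵥ u) i * star ((U *ᵥ v) j)‖ ≤
      3960 * ε * B := fun i j => by
    refine (norm_mul_star_sub_le (γ := 1320 * ε) (by positivity) hε1 (entry u i) (entry v j)
      ((PiLp.norm_apply_le (WithLp.toLp 2 (R.u - U *ᵥ u)) i).trans h.u)
      ((PiLp.norm_apply_le (WithLp.toLp 2 (R.v - U *ᵥ v)) j).trans h.v)).trans ?_
    calc 3 * (1320 * ε) * (‖WithLp.toLp 2 u‖ * ‖WithLp.toLp 2 v‖) ≤ 3 * (1320 * ε) * B := by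
          gcongr
      _ = _ := by ring
  -- With `δ = 14000 ε B` and `τ = 3960 ε B`, the larger quantity `2δ + 2τ` is `35920 ε B`.
  obtain ⟨h1, h2⟩ := Generators.norm_toMatrix_sub_le h.mem hκ h.low hτ
  refine ⟨l2_opNorm_le_of_forall_norm_apply_le (by positivity) fun i j => ?_, by linarith,
    vec h.u, vec h.v⟩
  refine (h1 i j).trans ?_
  linarith

/-- The matrix `M` and the vectors `x`, `y` are what `m` approximate similarities can make
of `A`, `u`, `v`, where `S` bounds the size of the data. -/
structure AccumulatedError (ε S : ℝ) (A : Matrix (Fin n) (Fin n) ℂ) (u v : Fin n → ℂ) (m : ℕ)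
    (M : Matrix (Fin n) (Fin n) ℂ) (x y : Fin n → ℂ) : Prop where
  similar : ∃ Q ∈ Matrix.unitaryGroup (Fin n) ℂ,
    ‖M - Q * A * Qᴴ‖ ≤ n * m ^ 2 * (144000 * ε * S)
  skew : ‖skewDefect M x y‖ ≤ m * (144000 * ε * S)
  fst : ‖WithLp.toLp 2 x‖ ≤ (1 + 2640 * m * ε) * ‖WithLp.toLp 2 u‖
  snd : ‖WithLp.toLp 2 y‖ ≤ (1 + 2640 * m * ε) * ‖WithLp.toLp 2 v‖

namespace AccumulatedError

variable {A M : Matrix (Fin n) (Fin n) ℂ} {u v x y : Fin n → ℂ} {m : ℕ}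

theorem norm_mul_norm_le (hm : 2640 * m * ε ≤ 1)
    (huv : ‖WithLp.toLp 2 u‖ * ‖WithLp.toLp 2 v‖ ≤ S) (h : AccumulatedError ε S A u v m M x y) :
    ‖WithLp.toLp 2 x‖ * ‖WithLp.toLp 2 y‖ ≤ 4 * S := by
  have two : ∀ {a : ℝ}, 0 ≤ a → (1 + 2640 * m * ε) * a ≤ 2 * a := fun ha => by gcongr; linarith
  calc ‖WithLp.toLp 2 x‖ * ‖WithLp.toLp 2 y‖
      ≤ (2 * ‖WithLp.toLp 2 u‖) * (2 * ‖WithLp.toLp 2 v‖) := by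
        gcongr
        · exact h.fst.trans (two (norm_nonneg _))
        · exact h.snd.trans (two (norm_nonneg _))
    _ = 4 * (‖WithLp.toLp 2 u‖ * ‖WithLp.toLp 2 v‖) := by ring
    _ ≤ 4 * S := by gcongr

theorem norm_matrix_le (hm : n * m ^ 2 * (144000 * ε) ≤ 1) (hA : ‖A‖ ≤ S)
    (h : AccumulatedError ε S A u v m M x y) : ‖M‖ ≤ 4 * S := by
  have hS : 0 ≤ S := (norm_nonneg _).trans hA
  obtain ⟨Q, hQ, hM⟩ := h.similar
  have h1 := norm_le_norm_sub_add M (Q * A * Qᴴ)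
  rw [norm_unitary_conj hQ] at h1
  nlinarith

/-- Taking `B = 4S` in `NearSim.bounds` gives the unit `144000 = 4 · 36000`. The defect gains one
unit; the distance to a similarity gains `n (m + 1)` units, and `m² + m + 1 ≤ (m + 1)²`. -/
theorem succ [Nonempty (Fin n)] (hε : 0 ≤ ε) (hε1 : 1320 * ε ≤ 1) (hm : 2640 * m * ε ≤ 1)
    (huv : ‖WithLp.toLp 2 u‖ * ‖WithLp.toLp 2 v‖ ≤ S) (h : AccumulatedError ε S A u v m M x y)
    {R : Generators n} {U : Matrix (Fin n) (Fin n) ℂ} (hR : NearSim ε (4 * S) M x y R U) :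
    AccumulatedError ε S A u v (m + 1) R.toMatrix R.u R.v := by
  have hS : 0 ≤ S := (mul_nonneg (norm_nonneg _) (norm_nonneg _)).trans huv
  have hεS : 0 ≤ ε * S := by positivity
  obtain ⟨b1, b2, b3, b4⟩ := hR.bounds hε hε1 (h.norm_mul_norm_le hm huv) h.skew
  obtain ⟨Q, hQ, hM⟩ := h.similar
  -- The growth rate is doubled from 1320 to 2640 so that it absorbs the cross term, as `2640 m ε ≤
  -- 1`.
  have vec : ∀ {a b c : ℝ}, 0 ≤ c → a ≤ (1 + 1320 * ε) * b → b ≤ (1 + 2640 * m * ε) * c →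
      a ≤ (1 + 2640 * ((m + 1 : ℕ) : ℝ) * ε) * c := fun {a b c} hc hab hbc => by
    push_cast
    calc a ≤ (1 + 1320 * ε) * ((1 + 2640 * m * ε) * c) := hab.trans (by gcongr)
      _ = (1 + 2640 * m * ε + 1320 * ε * (1 + 2640 * m * ε)) * c := by ring
      _ ≤ (1 + 2640 * m * ε + 1320 * ε * (1 + 1)) * c := by gcongr
      _ = _ := by ring
  refine ⟨⟨U * Q, mul_mem hR.mem hQ, ?_⟩, ?_, vec (norm_nonneg _) b3 h.fst,
    vec (norm_nonneg _) b4 h.snd⟩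
  · have e : R.toMatrix - U * Q * A * (U * Q)ᴴ =
        (R.toMatrix - U * M * Uᴴ) + U * (M - Q * A * Qᴴ) * Uᴴ := by
      simp only [Matrix.conjTranspose_mul, Matrix.mul_sub, Matrix.sub_mul, Matrix.mul_assoc]
      abel
    rw [e]
    refine (norm_add_le _ _).trans ?_
    rw [norm_unitary_conj hR.mem]
    refine (add_le_add b1 hM).trans ?_
    push_cast
    have : 0 ≤ n * m * (144000 * (ε * S)) := by positivity
    linarith
  · refine b2.trans ?_
    push_cast
    linarith

end AccumulatedError

/-- Storing the data counts as one approximate similarity with `U = 1`, hence `N + 1`. The smallness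
of `ε` keeps the data below `4S` throughout, so every step commits an error of the same size. -/
theorem QRRun.accumulatedError [Nonempty (Fin n)] {A : Matrix (Fin n) (Fin n) ℂ} {u v : Fin n → ℂ}
    {N : ℕ} {R₀ R : Generators n} (hε : 0 ≤ ε) (hN : n * (N + 1) ^ 2 * (144000 * ε) ≤ 1)
    (hA : ‖A‖ ≤ S) (huv : ‖WithLp.toLp 2 u‖ * ‖WithLp.toLp 2 v‖ ≤ S) (hskew : skewDefect A u v = 0)
    (h₀ : Stores ε A u v R₀) (h : QRRun ε N R₀ R) :
    AccumulatedError ε S A u v (N + 1) R.toMatrix R.u R.v := by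
  have hn : (1 : ℝ) ≤ n := by
    exact_mod_cast Fin.pos_iff_nonempty.2 ‹_›
  have small : ∀ m : ℕ, m ≤ N + 1 → n * m ^ 2 * (144000 * ε) ≤ 1 := fun m hm => by
    refine le_trans ?_ hN
    have : (m : ℝ) ≤ N + 1 := by exact_mod_cast hm
    gcongr
  have small' : ∀ m : ℕ, m ≤ N + 1 → 2640 * m * ε ≤ 1 := fun m hm => by
    refine le_trans ?_ (small m hm)
    have h1 : (m : ℝ) ≤ n * m ^ 2 := by
      have : (m : ℝ) ≤ (m : ℝ) ^ 2 := by exact_mod_cast Nat.le_self_pow two_ne_zero m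
      nlinarith [sq_nonneg (m : ℝ)]
    nlinarith
  have hε1 : 144000 * ε ≤ 1 := by
    have := small 1 (by omega)
    push_cast at this
    nlinarith
  have hS : 0 ≤ S := (norm_nonneg _).trans hA
  induction N generalizing R with
  | zero =>
    cases h
    have h0 : AccumulatedError ε S A u v 0 A u v :=
      ⟨⟨1, one_mem _, by simp⟩, by simp [hskew], by simp, by simp⟩
    exact h0.succ hε (by linarith) (by simp) huv (h₀.nearSim hε (by linarith))
  | succ N ih =>
    cases h with
    | step h hs =>
      have hR := ih (by simpa using small (N + 1) (by omega)) h (fun m hm => small m (by omega))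
        (fun m hm => small' m (by omega))
      obtain ⟨U, hU⟩ := hs.exists_nearSim hε (by linarith)
        (hR.norm_matrix_le (small (N + 1) (by omega)) hA)
        (hR.norm_mul_norm_le (small' (N + 1) (by omega)) huv)
      exact hR.succ hε (by linarith) (small' (N + 1) (by omega)) huv hU

/-- Backward stability of the structured QR iteration for a Hermitian-plus-rank-one matrix. -/
theorem ComputedSchurForm.backward_stable [Nonempty (Fin n)] {A T : Matrix (Fin n) (Fin n) ℂ}
    {u v : Fin n → ℂ} {N : ℕ} (hε : 0 ≤ ε) (hN : n * (N + 1) ^ 2 * (144000 * ε) ≤ 1)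
    (hA : ‖A‖ ≤ S) (huv : ‖WithLp.toLp 2 u‖ * ‖WithLp.toLp 2 v‖ ≤ S) (hskew : skewDefect A u v = 0)
    (h : ComputedSchurForm ε A u v N T) :
    T.BlockTriangular id ∧ ∃ Q ∈ Matrix.unitaryGroup (Fin n) ℂ, ∃ δA : Matrix (Fin n) (Fin n) ℂ,
      T = Qᴴ * (A + δA) * Q ∧ ‖δA‖ ≤ n * (N + 2) ^ 2 * (144000 * ε * S) := by
  obtain ⟨R₀, R, h₀, hrun, hz, hT⟩ := h
  have hS : 0 ≤ S := (norm_nonneg _).trans hA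
  have hεS : 0 ≤ ε * S := by positivity
  have hn : (1 : ℝ) ≤ n := by
    exact_mod_cast Fin.pos_iff_nonempty.2 ‹_›
  have hN1 : (1 : ℝ) ≤ n * (N + 1) ^ 2 :=
    one_le_mul_of_one_le_of_one_le hn (one_le_pow₀ (by simp))
  have hN2 : (N + 1 : ℝ) ≤ n * (N + 1) ^ 2 := by
    have : (N + 1 : ℝ) ≤ (N + 1) ^ 2 := le_self_pow₀ (by simp) two_ne_zero
    nlinarith [sq_nonneg (N + 1 : ℝ)]
  have hacc := hrun.accumulatedError hε hN hA huv hskew h₀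
  refine ⟨fun i j hij => ?_, ?_⟩
  · rw [hT.1 i j (le_of_lt hij)]
    exact hz i j hij
  · obtain ⟨Q, hQ, hM⟩ := hacc.similar
    -- Evaluating `T` adds `680 n ε S`, absorbed by passing from `(N + 1)²` to `(N + 2)²`.
    have hW : ‖T - R.toMatrix‖ ≤ n * (170 * ε * (4 * S)) :=
      l2_opNorm_le_of_forall_norm_apply_le (by positivity) <|
        hT.norm_sub_le hε (by nlinarith)
          (hacc.norm_matrix_le (by exact_mod_cast hN) hA)
          (hacc.norm_mul_norm_le (by push_cast; nlinarith) huv)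
    have hQ1 : Qᴴ * Q = 1 := (Matrix.mem_unitaryGroup_iff').1 hQ
    have hQ2 : Q * Qᴴ = 1 := (Matrix.mem_unitaryGroup_iff).1 hQ
    have hcancel : ∀ X : Matrix (Fin n) (Fin n) ℂ, Q * (Qᴴ * X * Q) * Qᴴ = X := fun X => by
      rw [← Matrix.mul_assoc, ← Matrix.mul_assoc, hQ2, one_mul, Matrix.mul_assoc, hQ2, mul_one]
    refine ⟨Qᴴ, Unitary.star_mem hQ, Qᴴ * (T - Q * A * Qᴴ) * Q, ?_, ?_⟩
    · rw [Matrix.conjTranspose_conjTranspose, Matrix.mul_add, Matrix.add_mul, hcancel]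
      abel
    · rw [← norm_unitary_conj hQ, hcancel]
      have e : T - Q * A * Qᴴ = (T - R.toMatrix) + (R.toMatrix - Q * A * Qᴴ) := by abel
      rw [e]
      refine (norm_add_le _ _).trans ((add_le_add hW hM).trans ?_)
      push_cast
      have h1 : 0 ≤ n * (ε * S) := by positivity
      have h2 : 0 ≤ n * (ε * S) * N := by positivity
      nlinarith

end Run

/-! ### The colleague matrix -/

section Colleague

variable {n : ℕ}

theorem conjTranspose_colleagueF : (colleagueF n)ᴴ = colleagueF n := by
  ext i j
  simp only [Matrix.conjTranspose_apply, colleagueF, or_comm (a := (i : ℕ) = j + 1),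
    or_comm (a := (j : ℕ) + 1 = n)]
  split_ifs <;> simp

theorem skewDefect_colleague (p : ℕ → ℂ) :
    skewDefect (colleague n p) (colleagueU n) (colleagueV n p) = 0 := by
  rw [skewDefect, colleague, add_sub_cancel_right, conjTranspose_colleagueF, sub_self]

theorem norm_colleagueF_apply_le (i j : Fin n) : ‖colleagueF n i j‖ ≤ 1 := by
  have h2 : √2 ≤ 2 := Real.sqrt_le_iff.2 (by norm_num)
  unfold colleagueF
  split_ifs
  · rw [Complex.norm_of_nonneg (by positivity)]
    linarith
  · norm_num
  · norm_num

theorem half_le_norm_colleagueF_apply {i j : Fin n} (h : (i : ℕ) = j + 1) :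
    1 / 2 ≤ ‖colleagueF n i j‖ := by
  have h2 : (1 : ℝ) ≤ √2 := Real.one_le_sqrt.2 (by norm_num)
  rw [colleagueF, if_pos (Or.inr h)]
  split_ifs
  · rw [Complex.norm_of_nonneg (by positivity)]
    linarith
  · norm_num

/-- The rank-one term lives in the first row, so the entry below the corner is that of `F` for every
`p`. Absolute constants can thus be absorbed into `‖A‖`. -/
theorem half_le_norm_colleague (hn : 2 ≤ n) (p : ℕ → ℂ) : 1 / 2 ≤ ‖colleague n p‖ := by
  have h := norm_apply_le_l2_opNorm (colleague n p) ⟨1, by omega⟩ ⟨0, by omega⟩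
  rw [colleague, Matrix.add_apply, Matrix.vecMulVec_apply, colleagueU, if_neg one_ne_zero, zero_mul,
    add_zero] at h
  exact (half_le_norm_colleagueF_apply rfl).trans h

theorem colleagueU_eq_single {i : Fin n} (hi : (i : ℕ) = 0) : colleagueU n = Pi.single i 1 := by
  ext j
  simp [colleagueU, Pi.single_apply, Fin.ext_iff, hi]

theorem norm_toLp_colleagueU (hn : 2 ≤ n) : ‖WithLp.toLp 2 (colleagueU n)‖ = 1 := by
  rw [colleagueU_eq_single (i := ⟨0, by omega⟩) rfl, PiLp.toLp_single, PiLp.norm_single, norm_one]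

/-- Since `v = A* e₁ - F e₁` and `F e₁` has one nonzero entry, of modulus at most `1 ≤ 2 ‖A‖`, the
rank-one term cannot be much larger than `A`. This makes the final error relative to `‖A‖`. -/
theorem norm_toLp_colleagueV_le (hn : 2 ≤ n) (p : ℕ → ℂ) :
    ‖WithLp.toLp 2 (colleagueV n p)‖ ≤ 3 * ‖colleague n p‖ := by
  obtain ⟨i, hi⟩ : ∃ i : Fin n, (i : ℕ) = 0 := ⟨⟨0, by omega⟩, rfl⟩
  obtain ⟨k, hk⟩ : ∃ k : Fin n, (k : ℕ) = 1 := ⟨⟨1, by omega⟩, rfl⟩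
  have e : colleagueV n p =
      (colleague n p)ᴴ *ᵥ Pi.single i 1 - Pi.single k (colleagueF n k i) := by
    have hF : colleagueF n *ᵥ Pi.single i 1 = Pi.single k (colleagueF n k i) := by
      ext j
      rw [Matrix.mulVec_single_one, Matrix.col_apply]
      by_cases hj : j = k
      · rw [hj, Pi.single_eq_same]
      · have hj' : (j : ℕ) ≠ 1 := fun h => hj (Fin.ext (h.trans hk.symm))
        rw [Pi.single_eq_of_ne hj, colleagueF, if_neg (by omega)]
    have hu : star (colleagueU n) ⬝ᵥ Pi.single i 1 = 1 := by
      simp [colleagueU_eq_single hi]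
    rw [colleague, Matrix.conjTranspose_add, conjTranspose_colleagueF, Matrix.add_mulVec, hF,
      add_sub_cancel_left, Matrix.conjTranspose_vecMulVec, star_star, Matrix.vecMulVec_mulVec, hu]
    simp
  have h1 := norm_toLp_mulVec_le (colleague n p)ᴴ (Pi.single i 1)
  rw [PiLp.toLp_single, PiLp.norm_single, norm_one, mul_one, Matrix.l2_opNorm_conjTranspose] at h1
  have h2 : ‖WithLp.toLp 2 (Pi.single k (colleagueF n k i) : Fin n → ℂ)‖ ≤ 1 := by
    rw [PiLp.toLp_single, PiLp.norm_single]
    exact norm_colleagueF_apply_le k i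
  rw [e, WithLp.toLp_sub]
  refine (norm_sub_le _ _).trans ?_
  linarith [half_le_norm_colleague hn p]

end Colleague

/-! ### The backward error bound for colleague matrices. -/

theorem theorem3p2 (q : Polynomial ℕ) :
    ∃ P : Polynomial ℕ, P.natDegree ≤ 2 * q.natDegree + 2 ∧
      ∀ (n : ℕ), 2 ≤ n →
      ∀ (p : Polynomial ℂ) (a : ℕ → ℂ),
        p = ∑ j ∈ Finset.range (n + 1), Polynomial.C (a j) * Polynomial.Chebyshev.T ℂ (j : ℤ) →
        a n ≠ 0 →
      ∀ (ε : ℝ), 0 < ε → ((P.eval n : ℕ) : ℝ) * ε ≤ 1 →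
      ∀ (N : ℕ), N ≤ q.eval n →
      ∀ (T : Matrix (Fin n) (Fin n) ℂ),
        ComputedSchurForm ε (colleague n a) (colleagueU n) (colleagueV n a) N T →
        T.BlockTriangular id ∧
        ∃ Q ∈ Matrix.unitaryGroup (Fin n) ℂ, ∃ δA : Matrix (Fin n) (Fin n) ℂ,
          T = Qᴴ * (colleague n a + δA) * Q ∧
          ‖δA‖ ≤ ((P.eval n : ℕ) : ℝ) * ‖colleague n a‖ * ε := by
  -- The factor is `3 · 144000`, from `S = 3 ‖A‖`, and `q + 2` dominates `N + 2`.
  refine ⟨Polynomial.C 432000 * Polynomial.X * (q + Polynomial.C 2) ^ 2, ?_, ?_⟩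
  · refine Polynomial.natDegree_mul_le.trans ?_
    have h1 := (Polynomial.natDegree_C_mul_le (432000 : ℕ) Polynomial.X).trans
      Polynomial.natDegree_X_le
    have h2 := Polynomial.natDegree_pow_le (p := q + Polynomial.C 2) (n := 2)
    rw [Polynomial.natDegree_add_C] at h2
    omega
  · intro n hn _ a _ _ ε hε hP N hN T hT
    have : Nonempty (Fin n) := ⟨⟨0, by omega⟩⟩
    have hPn : (((Polynomial.C 432000 * Polynomial.X * (q + Polynomial.C 2) ^ 2).eval n : ℕ) : ℝ) =
        432000 * n * ((q.eval n : ℕ) + 2) ^ 2 := by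
      simp
    rw [hPn] at hP ⊢
    have hN' : (N : ℝ) ≤ (q.eval n : ℕ) := by exact_mod_cast hN
    obtain ⟨hT, Q, hQ, δA, hTQ, hδ⟩ := hT.backward_stable (S := 3 * ‖colleague n a‖) hε.le
      (le_trans (by
        calc n * (N + 1) ^ 2 * (144000 * ε) ≤ n * ((q.eval n : ℕ) + 2) ^ 2 * (432000 * ε) := by
              gcongr <;> norm_num
          _ = _ := by ring) hP)
      (by linarith [norm_nonneg (colleague n a)])
      (by rw [norm_toLp_colleagueU hn, one_mul]; exact norm_toLp_colleagueV_le hn a)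
      (skewDefect_colleague a)
    refine ⟨hT, Q, hQ, δA, hTQ, hδ.trans ?_⟩
    calc n * (N + 2) ^ 2 * (144000 * ε * (3 * ‖colleague n a‖))
        ≤ n * ((q.eval n : ℕ) + 2) ^ 2 * (144000 * ε * (3 * ‖colleague n a‖)) := by gcongr
      _ = _ := by ring
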